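/- **Formal extension theorem.** Let $W$ be a smooth $(n+k)$-dimensional manifold (Hausdorff, second countable, without boundary) with a smooth Riemannian metric, and let $\zeta\subset TW$ be a smooth $n$-dimensional distribution, not necessarily integrable (for instance $\zeta=T\mathcal F$ for an $n$-dimensional foliation $\mathcal F$). Fix $r\in\{0,1,\dots,\infty\}$. All objects below are of class $C^r$; for objects defined over a subset of $W$ this means that near each point of the subset they are restrictions of $C^r$ objects defined on an open subset of $W$. A *formal leafwise Igusa function* ($\zeta$-FLIF) on an open set $U\subset W$ is a quadruple $\Phi=(\Phi^0,\Phi^1,\Phi^2,\lambda^+)$, where * $\Phi^0:U\to\mathbb R$ is a function; * $\Phi^1$ is a vector field on $U$ tangent to $\zeta$; let $V=V(\Phi)\subset U$ be its zero set; * $\Phi^2$ is a field of self-adjoint operators $\Phi^2_v:\zeta_v\to\zeta_v$, $v\in V$, which has rank $n-1$ at the points of a subset $\Sigma=\Sigma(\Phi)\subset V$ and rank $n$ at the points of $V\setminus\Sigma$; * $\lambda^+$ is a field of unit vectors over $\Sigma$ in the line bundle $\operatorname{Ker}\Phi^2|_\Sigma$. Let $V^i\subset V\setminus\Sigma$ and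 $\Sigma^i\subset\Sigma$ be the sets of points at which the index of $\Phi^2$ (the dimension of the sum of the eigenspaces with negative eigenvalues, called the negative eigenspace) equals $i$. A *framing* of $\Phi$ is a tuple $\xi=(\xi^1,\dots,\xi^n)$ of fields of unit vectors in $\zeta$ such that * $\xi^i$ is defined over $\Sigma^{i-1}\cup V^i\cup\Sigma^i\cup\dots\cup\Sigma^{n-1}\cup V^n$; * $\xi^i=\lambda^+$ over $\Sigma^{i-1}$; * $(\xi^1,\dots,\xi^i)$ is an orthonormal frame of the negative eigenspace of $\Phi^2$ at each point of $V^i$ and at each point of $\Sigma^i$. **Theorem.** Let $A\subset W$ be a closed (possibly empty) subset, and let $(\Phi,\xi)$ be a framed $\zeta$-FLIF on an open neighborhood $U$ of $A$. Then there exists a framed $\zeta$-FLIF $(\widetilde\Phi,\widetilde\xi)$ on the whole of $W$ which coincides with $(\Phi,\xi)$ over some open neighborhood $O\subset U$ of $A$. -/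

import Mathlib

open Set
open scoped Manifold ContDiff Topology

namespace FormalIgusa

noncomputable section

/-- A smooth field of `n`-planes `ζ ⊂ TW` on a `d`-dimensional manifold `W` (not necessarily
integrable), i.e. a smooth rank `n` subbundle of `TW`: near every point it is spanned by `n` smooth
vector fields. -/
structure PlaneField (n d : ℕ) (W : Type*) [TopologicalSpace W]
    [ChartedSpace (EuclideanSpace ℝ (Fin d)) W] [IsManifold (𝓡 d) ∞ W] where
  /-- the plane at a point -/
  fiber : ∀ x : W, Submodule ℝ (TangentSpace (𝓡 d) x)
  finrank_fiber : ∀ x, Module.finrank ℝ (fiber x) = n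
  exists_frame : ∀ x₀ : W, ∃ N : Set W, IsOpen N ∧ x₀ ∈ N ∧
    ∃ s : Fin n → ∀ x : W, TangentSpace (𝓡 d) x,
      (∀ i, ContMDiffOn (𝓡 d) (𝓡 d).tangent ∞
        (fun x => (⟨x, s i x⟩ : TangentBundle (𝓡 d) W)) N) ∧
      ∀ x ∈ N, Submodule.span ℝ (range fun i => s i x) = fiber x

/-- Smooth Riemannian metrics on `W`. -/
abbrev Metric (d : ℕ) (W : Type*) [TopologicalSpace W]
    [ChartedSpace (EuclideanSpace ℝ (Fin d)) W] [IsManifold (𝓡 d) ∞ W] :=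
  Bundle.ContMDiffRiemannianMetric (𝓡 d) ∞ (EuclideanSpace ℝ (Fin d))
    (fun x : W => TangentSpace (𝓡 d) x)

variable {n d : ℕ} {W : Type*} [TopologicalSpace W]
  [ChartedSpace (EuclideanSpace ℝ (Fin d)) W] [IsManifold (𝓡 d) ∞ W]

/-- The vector field `X`, of which only the values on the (arbitrary) subset `S ⊂ W` matter, is of
class `C^r` along `S`: near each point of `S` it is the restriction to `S` of a `C^r` vector field
defined on an open subset of `W`. -/
def SmoothAlong (r : ℕ∞) (S : Set W) (X : ∀ x : W, TangentSpace (𝓡 d) x) : Prop :=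
  ∀ x₀ ∈ S, ∃ N : Set W, IsOpen N ∧ x₀ ∈ N ∧ ∃ Y : ∀ x : W, TangentSpace (𝓡 d) x,
    ContMDiffOn (𝓡 d) (𝓡 d).tangent r (fun x => (⟨x, Y x⟩ : TangentBundle (𝓡 d) W)) N ∧
    ∀ x ∈ S ∩ N, Y x = X x

/-- The underlying data `(Φ⁰, Φ¹, Φ², λ⁺)` of a formal leafwise Igusa function. All components are
total functions; outside of the domains on which the definition speaks about them (an open set `U`
for `Φ⁰` and `Φ¹`, the zero set `V` of `Φ¹` in `U` for `Φ²`, and `Σ ⊂ V` for `λ⁺`) their values are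
irrelevant. -/
structure FormalData (ζ : PlaneField n d W) where
  /-- the function `Φ⁰` -/
  val : W → ℝ
  /-- the vector field `Φ¹` tangent to `ζ` -/
  grad : ∀ x, ζ.fiber x
  /-- the operator `Φ²` on the fibres of `ζ` -/
  hess : ∀ x, ζ.fiber x →ₗ[ℝ] ζ.fiber x
  /-- the vector field `λ⁺` -/
  lam : ∀ x, ζ.fiber x

namespace FormalData

variable {ζ : PlaneField n d W} (Φ : FormalData ζ) (U : Set W)

/-- `V(Φ)`: the set of zeros of `Φ¹` in `U`. -/
def V : Set W := {x | x ∈ U ∧ Φ.grad x = 0}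

/-- `Σ(Φ)`: the set of points of `V(Φ)` at which `Φ²` has rank `n - 1`. -/
def Sing : Set W := {x | x ∈ Φ.V U ∧ Module.finrank ℝ (LinearMap.range (Φ.hess x)) + 1 = n}

/-- The negative eigenspace of `Φ²` at `x`: the sum of the eigenspaces of all negative
eigenvalues (denoted `Vert₋` over `V ∖ Σ` and `Ver₋` over `Σ`). -/
def negSpace (x : W) : Submodule ℝ (ζ.fiber x) :=
  ⨆ (μ : ℝ) (_ : μ < 0), Module.End.eigenspace (Φ.hess x) μ

/-- The index of `Φ²` at `x`. -/
def index (x : W) : ℕ := Module.finrank ℝ (Φ.negSpace x)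

/-- `V^m`: the points of `V ∖ Σ` of index `m`. -/
def VStratum (m : ℕ) : Set W := {x | x ∈ Φ.V U \ Φ.Sing U ∧ Φ.index x = m}

/-- `Σ^m`: the points of `Σ` of index `m`. -/
def SingStratum (m : ℕ) : Set W := {x | x ∈ Φ.Sing U ∧ Φ.index x = m}

/-- The set `Σ^i ∪ V^{i+1} ∪ Σ^{i+1} ∪ V^{i+2} ∪ ⋯`, on which the framing vector field number `i`
(counted from `0`) is defined. -/
def frameDomain (i : ℕ) : Set W :=
  {x | ∃ m, i ≤ m ∧ (x ∈ Φ.SingStratum U m ∨ x ∈ Φ.VStratum U (m + 1))}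

end FormalData

/-- `Φ` is a formal leafwise Igusa function (a `ζ`-FLIF) of class `C^r` on the open set `U`. The
operator field `Φ²` is of class `C^r` along `V` in the sense that it takes sections of `ζ` that are
of class `C^r` along `V` to sections that are of class `C^r` along `V`. -/
structure IsFLIF (g : Metric d W) {ζ : PlaneField n d W} (r : ℕ∞) (U : Set W)
    (Φ : FormalData ζ) : Prop where
  val_smooth : ContMDiffOn (𝓡 d) 𝓘(ℝ, ℝ) r Φ.val U
  grad_smooth : ContMDiffOn (𝓡 d) (𝓡 d).tangent r
    (fun x => (⟨x, (Φ.grad x : TangentSpace (𝓡 d) x)⟩ : TangentBundle (𝓡 d) W)) U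
  hess_smooth : ∀ X : (∀ x, ζ.fiber x),
    SmoothAlong r (Φ.V U) (fun x => (X x : TangentSpace (𝓡 d) x)) →
    SmoothAlong r (Φ.V U) (fun x => (Φ.hess x (X x) : TangentSpace (𝓡 d) x))
  hess_symm : ∀ x ∈ Φ.V U, ∀ u v : ζ.fiber x,
    g.inner x (Φ.hess x u : TangentSpace (𝓡 d) x) (v : TangentSpace (𝓡 d) x) =
      g.inner x (u : TangentSpace (𝓡 d) x) (Φ.hess x v : TangentSpace (𝓡 d) x)
  hess_rank : ∀ x ∈ Φ.V U \ Φ.Sing U, Module.finrank ℝ (LinearMap.range (Φ.hess x)) = n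
  lam_smooth : SmoothAlong r (Φ.Sing U) (fun x => (Φ.lam x : TangentSpace (𝓡 d) x))
  lam_ker : ∀ x ∈ Φ.Sing U, Φ.hess x (Φ.lam x) = 0
  lam_unit : ∀ x ∈ Φ.Sing U,
    g.inner x (Φ.lam x : TangentSpace (𝓡 d) x) (Φ.lam x : TangentSpace (𝓡 d) x) = 1

/-- `ξ` (numbered from `0`, with irrelevant values outside of the domains) is a framing of class
`C^r` of the formal leafwise Igusa function `Φ` on `U`: `ξ i` is a unit vector field on its domain,
it is equal to `λ⁺` on `Σ^i`, and the first `m` fields form an orthonormal frame of the negative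
eigenspace of `Φ²` at all points of `V` of index `m`. -/
structure IsFraming (g : Metric d W) {ζ : PlaneField n d W} (r : ℕ∞) (U : Set W)
    (Φ : FormalData ζ) (ξ : Fin n → ∀ x, ζ.fiber x) : Prop where
  smooth : ∀ i : Fin n, SmoothAlong r (Φ.frameDomain U i) (fun x => (ξ i x : TangentSpace (𝓡 d) x))
  unit : ∀ i : Fin n, ∀ x ∈ Φ.frameDomain U i,
    g.inner x (ξ i x : TangentSpace (𝓡 d) x) (ξ i x : TangentSpace (𝓡 d) x) = 1
  eq_lam : ∀ i : Fin n, ∀ x ∈ Φ.SingStratum U i, ξ i x = Φ.lam x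
  orthogonal : ∀ m, ∀ x ∈ Φ.VStratum U m ∪ Φ.SingStratum U m,
    ∀ i j : Fin n, (i : ℕ) < m → (j : ℕ) < m → i ≠ j →
      g.inner x (ξ i x : TangentSpace (𝓡 d) x) (ξ j x : TangentSpace (𝓡 d) x) = 0
  span_eq : ∀ m, ∀ x ∈ Φ.VStratum U m ∪ Φ.SingStratum U m,
    Submodule.span ℝ ((fun i : Fin n => ξ i x) '' {i | (i : ℕ) < m}) = Φ.negSpace x

/-- The framed formal leafwise Igusa functions `(Φ, ξ)` and `(Φ', ξ')` (defined on open sets that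
contain `O`) coincide over the open set `O`: each component of the first one agrees with that of the
second one on the part over `O` of its domain of definition. -/
structure AgreeOn {ζ : PlaneField n d W} (O : Set W)
    (Φ Φ' : FormalData ζ) (ξ ξ' : Fin n → ∀ x, ζ.fiber x) : Prop where
  val_eq : ∀ x ∈ O, Φ'.val x = Φ.val x
  grad_eq : ∀ x ∈ O, Φ'.grad x = Φ.grad x
  hess_eq : ∀ x ∈ Φ.V O, Φ'.hess x = Φ.hess x
  lam_eq : ∀ x ∈ Φ.Sing O, Φ'.lam x = Φ.lam x
  frame_eq : ∀ i : Fin n, ∀ x ∈ Φ.frameDomain O i, ξ' i x = ξ i x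

end

end FormalIgusa

/-!
The framing makes it possible to turn `Φ²` into the identity along the zero set of `Φ¹` without
leaving the class of framed operators; once this is done near the boundary of a neighbourhood of
`A`, the vector field can be cut off to zero and the operator field continued by the identity, which
has index zero and needs no framing vectors.

A symmetric operator with a kernel of dimension at most one and its framing are described together
by `FramedType`: if `p` is the sum of index and nullity, the first `p` framing vectors are
orthonormal and span the nonpositive invariant subspace, and if there is a kernel it is spanned by
the last one. So `λ⁺` is redundant, and a framed formal leafwise Igusa function is essentially a
`FramedField` along the zero set (`IsFraming.framedField`, `FramedField.isFLIF`,
`FramedField.isFraming`). Along the whole deformation the framing `ξ` stays the same, and only its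
domain shrinks.

The main step is `FramedField.exists_lower`: if `p ≤ k + 1` outside of `Ω`, the set where
`p = k + 1` is closed there, because `p` is upper semicontinuous (`FramedField.eventually_type`), so
the last framing vector `ξ k` extends to a unit field `e` near this set, orthogonal to the vectors
`ξ i` with `i < k`. Deleting the off-diagonal blocks of the operator with respect to `e`, and then
adding a growing multiple of the projection to `e` (`bend`), moves this one eigenvalue from
negative, through zero with kernel `ξ k`, to positive (`FramedType.bend_last`). At the neighbouring
points where `p = k` nothing changes (`FramedType.bend_perp`). After `n` such steps
(`FramedField.exists_positive`) the operator is positive definite away from `A`, and is deformed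
linearly to the identity (`FramedField.extend_by_id`).
-/

namespace FormalIgusa

/-! ### Symmetric operators and orthonormal flags -/

section LinearAlgebra

open Module

variable {E : Type*} [AddCommGroup E] [Module ℝ E]

/-- A positive definite symmetric bilinear form. -/
structure IsInner (B : LinearMap.BilinForm ℝ E) : Prop where
  symm : ∀ u v, B u v = B v u
  pos : ∀ v, v ≠ 0 → 0 < B v v

/-- The span of the first `p` vectors of the tuple `ξ`. -/
def flag {n : ℕ} (ξ : Fin n → E) (p : ℕ) : Submodule ℝ E :=
  Submodule.span ℝ (ξ '' {i | (i : ℕ) < p})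

/-- The sum of the eigenspaces of all negative eigenvalues. -/
def negEigen (T : E →ₗ[ℝ] E) : Submodule ℝ E :=
  ⨆ (μ : ℝ) (_ : μ < 0), End.eigenspace T μ

/-- The inner product space structure given by a positive definite form. -/
@[reducible]
def IsInner.core {B : LinearMap.BilinForm ℝ E} (hB : IsInner B) : InnerProductSpace.Core ℝ E where
  inner u v := B u v
  conj_inner_symm u v := by simpa using hB.symm v u
  re_inner_nonneg v := by
    by_cases h : v = 0
    · simp [h]
    · simpa using (hB.pos v h).le
  add_left u v w := by simp
  smul_left u v a := by simp
  definite v h := by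
    by_contra h'
    exact (hB.pos v h').ne' h

theorem IsInner.eq_zero {B : LinearMap.BilinForm ℝ E} (hB : IsInner B) {v : E} (h : B v v = 0) :
    v = 0 := by
  by_contra h'
  exact (hB.pos v h').ne' h

theorem IsInner.exists_decomp [FiniteDimensional ℝ E] {B : LinearMap.BilinForm ℝ E}
    (hB : IsInner B) (N : Submodule ℝ E) (v : E) :
    ∃ u ∈ N, ∃ w, v = u + w ∧ ∀ u' ∈ N, B w u' = 0 := by
  let : NormedAddCommGroup E := @InnerProductSpace.Core.toNormedAddCommGroup ℝ E _ _ _ hB.core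
  let : InnerProductSpace ℝ E := InnerProductSpace.ofCore hB.core.toCore
  obtain ⟨u, hu, w, hw, h⟩ := N.exists_add_mem_mem_orthogonal v
  exact ⟨u, hu, w, h, fun u' hu' => (N.mem_orthogonal' w).1 hw u' hu'⟩

theorem IsInner.finrank_orthogonal [FiniteDimensional ℝ E] {B : LinearMap.BilinForm ℝ E}
    (hB : IsInner B) (N : Submodule ℝ E) :
    ∃ P : Submodule ℝ E, finrank ℝ N + finrank ℝ P = finrank ℝ E ∧
      ∀ v, v ∈ P ↔ ∀ u ∈ N, B v u = 0 := by
  let : NormedAddCommGroup E := @InnerProductSpace.Core.toNormedAddCommGroup ℝ E _ _ _ hB.core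
  let : InnerProductSpace ℝ E := InnerProductSpace.ofCore hB.core.toCore
  exact ⟨Nᗮ, N.finrank_add_finrank_orthogonal, fun v => N.mem_orthogonal' v⟩

/-- The spectral theorem, in terms of signs: a symmetric operator is negative definite on the sum of
its eigenspaces with negative eigenvalues and nonnegative on the orthogonal complement. -/
theorem negEigen_sign [FiniteDimensional ℝ E] {B : LinearMap.BilinForm ℝ E} (hB : IsInner B)
    {T : E →ₗ[ℝ] E} (hT : ∀ u v, B (T u) v = B u (T v)) :
    (∀ u ∈ negEigen T, u ≠ 0 → B (T u) u < 0) ∧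
      ∀ v, (∀ u ∈ negEigen T, B v u = 0) → 0 ≤ B (T v) v := by
  let : NormedAddCommGroup E := @InnerProductSpace.Core.toNormedAddCommGroup ℝ E _ _ _ hB.core
  let : InnerProductSpace ℝ E := InnerProductSpace.ofCore hB.core.toCore
  have hS : T.IsSymmetric := hT
  have hin : ∀ u v : E, inner ℝ u v = B u v := fun _ _ => rfl
  set e := hS.eigenvectorBasis rfl with he
  set l := hS.eigenvalues rfl with hl
  have hTe : ∀ i, T (e i) = l i • e i := fun i => hS.apply_eigenvectorBasis rfl i
  have hq : ∀ v, B (T v) v = ∑ i, l i * (B v (e i)) ^ 2 := by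
    intro v
    rw [← hin, ← e.sum_inner_mul_inner]
    refine Finset.sum_congr rfl fun i _ => ?_
    rw [hS v (e i), hTe, hin, hin, hB.symm (e i) v, map_smul, smul_eq_mul]
    ring
  have hmem : ∀ i, l i < 0 → e i ∈ negEigen T := by
    intro i hi
    refine (le_iSup₂_of_le (l i) hi le_rfl :
      End.eigenspace T (l i) ≤ negEigen T) ?_
    rw [End.mem_eigenspace_iff]
    exact hTe i
  have hperp : ∀ i, 0 ≤ l i → ∀ u ∈ negEigen T, B u (e i) = 0 := by
    intro i hi u hu
    have : negEigen T ≤ LinearMap.ker (LinearMap.flip B (e i)) := by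
      refine iSup₂_le fun μ hμ v hv => ?_
      rw [End.mem_eigenspace_iff] at hv
      have h1 := hT v (e i)
      rw [hv, hTe] at h1
      simp only [map_smul, LinearMap.smul_apply, smul_eq_mul] at h1
      have : (l i - μ) * B v (e i) = 0 := by linarith
      rcases mul_eq_zero.1 this with h | h
      · linarith
      · simpa using h
    simpa using this hu
  refine ⟨fun u hu hu0 => ?_, fun v hv => ?_⟩
  · rw [hq]
    have hle : ∀ i ∈ Finset.univ, l i * (B u (e i)) ^ 2 ≤ 0 := by
      intro i _
      by_cases hi : 0 ≤ l i
      · simp [hperp i hi u hu]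
      · exact mul_nonpos_of_nonpos_of_nonneg (by linarith) (sq_nonneg _)
    refine lt_of_le_of_ne (Finset.sum_nonpos hle) fun h0 => hu0 ?_
    rw [Finset.sum_eq_zero_iff_of_nonpos hle] at h0
    apply hB.eq_zero
    rw [← hin, ← e.sum_inner_mul_inner]
    refine Finset.sum_eq_zero fun i _ => ?_
    have : B u (e i) = 0 := by
      by_cases hi : 0 ≤ l i
      · exact hperp i hi u hu
      · have := h0 i (Finset.mem_univ i)
        rcases mul_eq_zero.1 this with h | h
        · linarith
        · simpa using h
    rw [hin, this, zero_mul]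
  · rw [hq]
    refine Finset.sum_nonneg fun i _ => ?_
    by_cases hi : 0 ≤ l i
    · positivity
    · simp [hv (e i) (hmem i (not_le.1 hi))]

theorem negEigen_invariant {T : E →ₗ[ℝ] E} {u : E} (hu : u ∈ negEigen T) : T u ∈ negEigen T := by
  have : negEigen T ≤ (negEigen T).comap T := by
    refine iSup₂_le fun μ hμ v hv => ?_
    rw [Submodule.mem_comap, End.mem_eigenspace_iff.1 hv]
    exact Submodule.smul_mem _ _
      ((le_iSup₂_of_le μ hμ le_rfl : End.eigenspace T μ ≤ negEigen T) hv)
  exact this hu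

/-- An invariant subspace on which a symmetric operator is negative definite, such that the operator
is nonnegative on the orthogonal complement, is the negative eigenspace. -/
theorem negEigen_eq [FiniteDimensional ℝ E] {B : LinearMap.BilinForm ℝ E} (hB : IsInner B)
    {T : E →ₗ[ℝ] E} (hT : ∀ u v, B (T u) v = B u (T v)) {N : Submodule ℝ E}
    (inv : ∀ u ∈ N, T u ∈ N) (neg : ∀ u ∈ N, u ≠ 0 → B (T u) u < 0)
    (nonneg : ∀ v, (∀ u ∈ N, B v u = 0) → 0 ≤ B (T v) v) : negEigen T = N := by
  have hle : negEigen T ≤ N := by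
    refine iSup₂_le fun μ hμ v hv => ?_
    rw [End.mem_eigenspace_iff] at hv
    obtain ⟨u, hu, w, rfl, hw⟩ := hB.exists_decomp N v
    -- the component orthogonal to `N` is itself an eigenvector
    have h1 : B (T (u + w)) w = μ * B w w := by
      rw [hv]
      simp [hB.symm u w, hw u hu]
    have h2 : B (T u) w = 0 := by rw [hB.symm, hw _ (inv u hu)]
    rw [map_add, map_add, LinearMap.add_apply, h2, zero_add] at h1
    have h3 := nonneg w hw
    have h4 : w = 0 := by
      by_contra h
      have := hB.pos w h
      nlinarith
    simpa [h4] using hu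
  refine le_antisymm hle fun v hv => ?_
  obtain ⟨u, hu, w, rfl, hw⟩ := hB.exists_decomp (negEigen T) v
  have hwN : w ∈ N := by simpa using N.sub_mem hv (hle hu)
  have h1 := (negEigen_sign hB hT).2 w hw
  have h2 : w = 0 := by
    by_contra h
    linarith [neg w hwN h]
  simpa [h2] using hu

section Flag

variable {n : ℕ} {ξ : Fin n → E} {p : ℕ} {B : LinearMap.BilinForm ℝ E}

theorem mem_flag {i : Fin n} (hi : (i : ℕ) < p) : ξ i ∈ flag ξ p :=
  Submodule.subset_span ⟨i, hi, rfl⟩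

theorem flag_mono {q : ℕ} (h : p ≤ q) : flag ξ p ≤ flag ξ q :=
  Submodule.span_mono (image_mono fun _ hi => lt_of_lt_of_le hi h)

theorem perp_flag {v : E} (h : ∀ i : Fin n, (i : ℕ) < p → B v (ξ i) = 0) :
    ∀ u ∈ flag ξ p, B v u = 0 := by
  intro u hu
  have : flag ξ p ≤ LinearMap.ker (B v) := by
    refine Submodule.span_le.2 ?_
    rintro _ ⟨i, hi, rfl⟩
    exact h i hi
  exact this hu

theorem flag_invariant {T : E →ₗ[ℝ] E} {N : Submodule ℝ E}
    (h : ∀ i : Fin n, (i : ℕ) < p → T (ξ i) ∈ N) : ∀ u ∈ flag ξ p, T u ∈ N := by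
  intro u hu
  have : flag ξ p ≤ N.comap T := by
    refine Submodule.span_le.2 ?_
    rintro _ ⟨i, hi, rfl⟩
    exact h i hi
  exact this hu

theorem exists_of_mem_flag_succ {k : Fin n} {v : E} (hv : v ∈ flag ξ (k + 1)) :
    ∃ u ∈ flag ξ k, ∃ β : ℝ, v = u + β • ξ k := by
  have : {i : Fin n | (i : ℕ) < k + 1} = insert k {i : Fin n | (i : ℕ) < k} := by
    ext i
    simp only [mem_ofPred_eq, mem_insert_iff, Fin.ext_iff]
    omega
  rw [flag, this, image_insert_eq, Submodule.span_insert, sup_comm, Submodule.mem_sup] at hv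
  obtain ⟨u, hu, w, hw, rfl⟩ := hv
  obtain ⟨β, rfl⟩ := Submodule.mem_span_singleton.1 hw
  exact ⟨u, hu, β, rfl⟩

/-- The first `p` vectors of `ξ` are orthonormal. -/
def OrthonormalUpTo (B : LinearMap.BilinForm ℝ E) (ξ : Fin n → E) (p : ℕ) : Prop :=
  ∀ i j : Fin n, (i : ℕ) < p → (j : ℕ) < p → B (ξ i) (ξ j) = if i = j then 1 else 0

theorem OrthonormalUpTo.mono {q : ℕ} (h : OrthonormalUpTo B ξ q) (hpq : p ≤ q) :
    OrthonormalUpTo B ξ p := fun i j hi hj => h i j (hi.trans_le hpq) (hj.trans_le hpq)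

theorem OrthonormalUpTo.perp {k : Fin n} (h : OrthonormalUpTo B ξ (k + 1)) :
    ∀ u ∈ flag ξ k, B (ξ k) u = 0 := by
  refine perp_flag fun i hi => ?_
  rw [h k i (Nat.lt_succ_self _) (hi.trans (Nat.lt_succ_self _)), if_neg]
  rintro rfl
  exact lt_irrefl _ hi

theorem OrthonormalUpTo.mem_flag_of_perp {k : Fin n} (hB : IsInner B)
    (h : OrthonormalUpTo B ξ (k + 1)) {v : E} (hv : v ∈ flag ξ (k + 1)) (hk : B v (ξ k) = 0) :
    v ∈ flag ξ k := by
  obtain ⟨u, hu, β, rfl⟩ := exists_of_mem_flag_succ hv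
  have h1 := h k k (Nat.lt_succ_self _) (Nat.lt_succ_self _)
  have h2 := h.perp u hu
  rw [map_add, LinearMap.add_apply, hB.symm u, h2] at hk
  simp only [map_smul, LinearMap.smul_apply, smul_eq_mul, h1, if_true] at hk
  have : β = 0 := by linarith
  simpa [this] using hu

theorem OrthonormalUpTo.finrank_flag (h : OrthonormalUpTo B ξ p) (hp : p ≤ n) :
    finrank ℝ (flag ξ p) = p := by
  have hli : LinearIndependent ℝ (fun i : {i : Fin n // (i : ℕ) < p} => ξ i) := by
    rw [Fintype.linearIndependent_iff]
    intro c hc i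
    have h1 : B (ξ i) (∑ j, c j • ξ j) = 0 := by rw [hc, map_zero]
    rw [map_sum, Finset.sum_eq_single i] at h1
    · simpa [h i i i.2 i.2] using h1
    · intro j _ hj
      have : (i : Fin n) ≠ j := fun h => hj (Subtype.ext h.symm)
      simp [h i j i.2 j.2, this]
    · simp
  have h2 := finrank_span_eq_card hli
  have h3 : range (fun i : {i : Fin n // (i : ℕ) < p} => ξ i) = ξ '' {i | (i : ℕ) < p} := by
    rw [image_eq_range]
    rfl
  rw [h3] at h2
  rw [flag, h2, Fintype.card_subtype]
  have : (Finset.univ.filter fun i : Fin n => (i : ℕ) < p) =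
      Finset.univ.map (Fin.castLEEmb hp) := by
    ext i
    simp only [Finset.mem_filter, Finset.mem_univ, true_and, Finset.mem_map]
    constructor
    · intro hi
      exact ⟨⟨i, hi⟩, by ext; rfl⟩
    · rintro ⟨j, rfl⟩
      exact j.2
  rw [this]
  simp

end Flag

/-- The normal form of a symmetric operator `T` with respect to the framing `ξ`, where `p` is the
sum of the index and the nullity of `T`, and the nullity is at most one. The span of the first `p`
vectors is invariant, `T` is positive definite on the orthogonal complement and nonpositive on this
span; a null vector in the span is a multiple of the last one of the `p` vectors. -/
structure FramedType {n : ℕ} (B : LinearMap.BilinForm ℝ E) (T : E →ₗ[ℝ] E) (ξ : Fin n → E)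
    (p : ℕ) : Prop where
  le : p ≤ n
  orth : OrthonormalUpTo B ξ p
  inv : ∀ i : Fin n, (i : ℕ) < p → T (ξ i) ∈ flag ξ p
  pos : ∀ v, v ≠ 0 → (∀ i : Fin n, (i : ℕ) < p → B v (ξ i) = 0) → 0 < B (T v) v
  nonpos : ∀ v ∈ flag ξ p, B (T v) v ≤ 0
  null : ∀ v ∈ flag ξ p, B (T v) v = 0 → ∀ i : Fin n, (i : ℕ) + 1 < p → B v (ξ i) = 0

section Bend

variable (B : LinearMap.BilinForm ℝ E) (T : E →ₗ[ℝ] E) (η : E) (s c : ℝ)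

/-- The operator obtained from `T` by multiplying with `1 - s` the off-diagonal blocks with respect
to the splitting into the line of the unit vector `η` and its orthogonal complement, and by adding
`c` times the orthogonal projection to this line. -/
def bend : E →ₗ[ℝ] E :=
  T - s • ((B η).smulRight (T η - B (T η) η • η) +
    (B (T η) - B (T η) η • B η).smulRight η) + c • (B η).smulRight η

theorem bend_apply (v : E) : bend B T η s c v =
    T v - s • (B η v • (T η - B (T η) η • η) + (B (T η) v - B (T η) η * B η v) • η) +
      c • B η v • η := by
  simp [bend]

theorem bend_zero : bend B T η 0 0 = T := by
  ext v
  simp [bend_apply]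

variable {B T η}

theorem bend_symm (hB : IsInner B) (hT : ∀ u v, B (T u) v = B u (T v)) (u v : E) :
    B (bend B T η s c u) v = B u (bend B T η s c v) := by
  simp only [bend_apply, map_add, map_sub, map_smul, LinearMap.add_apply, LinearMap.sub_apply,
    LinearMap.smul_apply, smul_eq_mul]
  rw [hT u v, hB.symm u η, hB.symm u (T η)]
  ring

variable {s c}

/-- The quadratic form of the deformed operator interpolates between the one of `T` and its
block-diagonal part, up to the added multiple of the projection to `η`. -/
theorem bend_form (hB : IsInner B) (hT : ∀ u v, B (T u) v = B u (T v)) (h1 : B η η = 1)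
    {w : E} (hw : B η w = 0) (β : ℝ) :
    B (bend B T η s c (w + β • η)) (w + β • η) =
      (1 - s) * B (T (w + β • η)) (w + β • η) + s * (B (T w) w + β ^ 2 * B (T η) η) +
        c * β ^ 2 := by
  have h2 : B (T w) η = B (T η) w := by rw [hT, hB.symm]
  simp only [bend_apply, map_add, map_sub, map_smul, LinearMap.add_apply, LinearMap.sub_apply,
    LinearMap.smul_apply, smul_eq_mul, h1, hw, h2]
  ring

variable {n : ℕ} {ξ : Fin n → E}

/-- Bending along the last vector of the frame: as the diagonal entry grows, the last direction
moves from the negative eigenspace through the kernel to the positive eigenspace. -/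
theorem FramedType.bend_last (hB : IsInner B) (hT : ∀ u v, B (T u) v = B u (T v)) {k : Fin n}
    (h : FramedType B T ξ (k + 1)) (hs : s ≤ 1) (hs0 : 0 ≤ s) (hsc : s = 1 ∨ c = 0) :
    (B (T (ξ k)) (ξ k) + c ≤ 0 → FramedType B (bend B T (ξ k) s c) ξ (k + 1)) ∧
      (0 < B (T (ξ k)) (ξ k) + c → FramedType B (bend B T (ξ k) s c) ξ k) := by
  have hk : ξ k ∈ flag ξ (k + 1) := mem_flag (Nat.lt_succ_self _)
  have hkk : B (ξ k) (ξ k) = 1 := by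
    simpa using h.orth k k (Nat.lt_succ_self _) (Nat.lt_succ_self _)
  have hinv := flag_invariant h.inv
  have hbinv : ∀ i : Fin n, (i : ℕ) < k + 1 → bend B T (ξ k) s c (ξ i) ∈ flag ξ (k + 1) := by
    intro i hi
    rw [bend_apply]
    exact add_mem (sub_mem (h.inv i hi) (Submodule.smul_mem _ _ (add_mem (Submodule.smul_mem _ _
      (sub_mem (hinv _ hk) (Submodule.smul_mem _ _ hk))) (Submodule.smul_mem _ _ hk))))
      (Submodule.smul_mem _ _ (Submodule.smul_mem _ _ hk))
  have ha : B (T (ξ k)) (ξ k) ≤ 0 := h.nonpos _ hk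
  refine ⟨fun hac => ⟨h.le, h.orth, hbinv, ?_, ?_, ?_⟩, fun hac => ?_⟩
  · intro v hv0 hv
    have e1 : B (ξ k) v = 0 := by rw [hB.symm, hv k (Nat.lt_succ_self _)]
    have e2 := bend_form (s := s) (c := c) hB hT hkk e1 0
    simp only [zero_smul, add_zero] at e2
    rw [e2]
    have := h.pos v hv0 hv
    nlinarith
  · intro v hv
    obtain ⟨u, hu, β, rfl⟩ := exists_of_mem_flag_succ hv
    rw [bend_form hB hT hkk (h.orth.perp u hu)]
    have h1 := h.nonpos _ hv
    have h2 := h.nonpos u (flag_mono (Nat.le_succ _) hu)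
    rcases hsc with rfl | rfl
    · nlinarith [sq_nonneg β]
    · nlinarith [sq_nonneg β, mul_nonneg hs0 (mul_nonneg (sq_nonneg β) (neg_nonneg.2 ha)),
        mul_nonneg (sub_nonneg.2 hs) (neg_nonneg.2 h1), mul_nonneg hs0 (neg_nonneg.2 h2)]
  · intro v hv h0 i hi
    obtain ⟨u, hu, β, rfl⟩ := exists_of_mem_flag_succ hv
    rw [bend_form hB hT hkk (h.orth.perp u hu)] at h0
    have h1 := h.nonpos _ hv
    have hu' := flag_mono (Nat.le_succ _) hu
    have h2 := h.nonpos u hu'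
    have h3 : B (ξ k) (ξ i) = 0 := h.orth.perp _ (mem_flag (by omega))
    have hcase : s = 1 ∨ (s < 1 ∧ c = 0) := by
      rcases hs.lt_or_eq with h' | h'
      · exact Or.inr ⟨h', hsc.resolve_left h'.ne⟩
      · exact Or.inl h'
    rcases hcase with rfl | ⟨hs1, rfl⟩
    · have : B (T u) u = 0 := by nlinarith [sq_nonneg β]
      have := h.null u hu' this i hi
      simp [this, h3]
    · refine h.null _ hv (le_antisymm h1 ?_) i hi
      have e1 : s * (B (T u) u + β ^ 2 * B (T (ξ k)) (ξ k)) ≤ 0 :=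
        mul_nonpos_of_nonneg_of_nonpos hs0 (by nlinarith [sq_nonneg β])
      have e2 : 0 ≤ (1 - s) * B (T (u + β • ξ k)) (u + β • ξ k) := by linarith
      exact nonneg_of_mul_nonneg_right e2 (by linarith)
  · have hs1 : s = 1 := by
      rcases hsc with h' | h'
      · exact h'
      · linarith
    subst hs1
    have hu_form : ∀ u ∈ flag ξ k, B (bend B T (ξ k) 1 c u) u = B (T u) u := by
      intro u hu
      have := bend_form (s := 1) (c := c) hB hT hkk (h.orth.perp u hu) 0
      simpa using this
    refine ⟨(Nat.le_succ _).trans h.le, h.orth.mono (Nat.le_succ _), ?_, ?_, ?_, ?_⟩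
    · intro i hi
      refine h.orth.mem_flag_of_perp hB (hbinv i (by omega)) ?_
      have e1 : B (ξ k) (ξ i) = 0 := h.orth.perp _ (mem_flag hi)
      have e2 : B (T (ξ i)) (ξ k) = B (T (ξ k)) (ξ i) := by rw [hT, hB.symm]
      rw [bend_apply]
      simp [e1, e2, hkk]
    · intro v hv0 hv
      obtain ⟨w, hw, β, hvw⟩ : ∃ w, B (ξ k) w = 0 ∧ ∃ β : ℝ, v = w + β • ξ k :=
        ⟨v - B (ξ k) v • ξ k, by simp [hkk], B (ξ k) v, by simp⟩
      have hw' : ∀ i : Fin n, (i : ℕ) < k + 1 → B w (ξ i) = 0 := by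
        intro i hi
        by_cases hik : i = k
        · rw [hik, hB.symm, hw]
        · have hi' : (i : ℕ) < k := by
            have : (i : ℕ) ≠ k := fun h => hik (Fin.ext h)
            omega
          have e1 : B (ξ k) (ξ i) = 0 := h.orth.perp _ (mem_flag hi')
          have := hv i hi'
          rw [hvw] at this
          simpa [e1] using this
      rw [hvw, bend_form hB hT hkk hw]
      by_cases hw0 : w = 0
      · have hβ : β ≠ 0 := by
          rintro rfl
          simp [hw0] at hvw
          exact hv0 hvw
        have := mul_pos (sq_pos_of_ne_zero hβ) hac
        simp only [hw0, map_zero]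
        nlinarith
      · have := h.pos w hw0 hw'
        nlinarith [mul_nonneg (sq_nonneg β) hac.le]
    · intro u hu
      rw [hu_form u hu]
      exact h.nonpos u (flag_mono (Nat.le_succ _) hu)
    · intro u hu h0 i hi
      rw [hu_form u hu] at h0
      exact h.null u (flag_mono (Nat.le_succ _) hu) h0 i (by omega)

/-- Bending along a vector orthogonal to the nonpositive space does not change the type. -/
theorem FramedType.bend_perp (hB : IsInner B) (hT : ∀ u v, B (T u) v = B u (T v)) {p : ℕ}
    (h : FramedType B T ξ p) (hs : s ≤ 1) (hs0 : 0 ≤ s) (hc : 0 ≤ c) (h1 : B η η = 1)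
    (hη : ∀ i : Fin n, (i : ℕ) < p → B η (ξ i) = 0) : FramedType B (bend B T η s c) ξ p := by
  have hperp := perp_flag hη
  have heq : ∀ u ∈ flag ξ p, bend B T η s c u = T u := by
    intro u hu
    have e2 : B (T η) u = 0 := by rw [hT]; exact hperp _ (flag_invariant h.inv u hu)
    simp [bend_apply, hperp u hu, e2]
  refine ⟨h.le, h.orth, ?_, ?_, ?_, ?_⟩
  · intro i hi
    rw [heq _ (mem_flag hi)]
    exact h.inv i hi
  · intro v hv0 hv
    obtain ⟨w, hw, β, hvw⟩ : ∃ w, B η w = 0 ∧ ∃ β : ℝ, v = w + β • η :=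
      ⟨v - B η v • η, by simp [h1], B η v, by simp⟩
    have hw' : ∀ i : Fin n, (i : ℕ) < p → B w (ξ i) = 0 := by
      intro i hi
      have := hv i hi
      rw [hvw] at this
      simpa [hη i hi] using this
    have hη0 : η ≠ 0 := by
      rintro rfl
      simp at h1
    have ha := h.pos η hη0 hη
    have hpos := h.pos v hv0 hv
    have hsum : 0 < B (T w) w + β ^ 2 * B (T η) η := by
      by_cases hw0 : w = 0
      · have hβ : β ≠ 0 := by
          rintro rfl
          simp [hw0] at hvw
          exact hv0 hvw
        simp only [hw0, map_zero, zero_add]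
        exact mul_pos (sq_pos_of_ne_zero hβ) ha
      · have := h.pos w hw0 hw'
        positivity
    rw [hvw] at hpos ⊢
    rw [bend_form hB hT h1 hw]
    have := mul_nonneg hc (sq_nonneg β)
    rcases hs.lt_or_eq with h' | rfl
    · have := mul_pos (sub_pos.2 h') hpos
      have := mul_nonneg hs0 hsum.le
      linarith
    · linarith
  · intro u hu
    rw [heq u hu]
    exact h.nonpos u hu
  · intro u hu h0
    rw [heq u hu] at h0
    exact h.null u hu h0

end Bend

end LinearAlgebra

/-! ### The normal form and the spectral data -/

section NormalForm

open Module

variable {E : Type*} [AddCommGroup E] [Module ℝ E]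
  {B : LinearMap.BilinForm ℝ E} {T : E →ₗ[ℝ] E} {n : ℕ} {ξ : Fin n → E} {p : ℕ}

/-- A null vector of a nonnegative form on an invariant subspace lies in the kernel. -/
theorem apply_eq_zero_of_form_eq_zero (hB : IsInner B) (hT : ∀ u v, B (T u) v = B u (T v))
    {N : Submodule ℝ E} (inv : ∀ u ∈ N, T u ∈ N) (nonneg : ∀ u ∈ N, 0 ≤ B (T u) u) {v : E}
    (hv : v ∈ N) (h0 : B (T v) v = 0) : T v = 0 := by
  by_contra hne
  have ha := hB.pos _ hne
  -- the form at `v - t • T v` is `- 2 t ‖T v‖² + O(t²)`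
  have key : ∀ t : ℝ, 0 ≤ -2 * t * B (T v) (T v) + t ^ 2 * B (T (T v)) (T v) := by
    intro t
    have h := nonneg (v - t • T v) (N.sub_mem hv (N.smul_mem _ (inv v hv)))
    simp only [map_sub, map_smul, LinearMap.sub_apply, LinearMap.smul_apply, smul_eq_mul, h0] at h
    rw [hT (T v) v] at h
    linarith
  set a := B (T v) (T v)
  set b := B (T (T v)) (T v)
  have hb : 0 ≤ b := nonneg _ (inv v hv)
  have h := key (a / (b + 1))
  have h2 : -2 * (a / (b + 1)) * a + (a / (b + 1)) ^ 2 * b =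
      a ^ 2 / (b + 1) ^ 2 * (-(b + 2)) := by
    field_simp
    ring
  rw [h2] at h
  have : 0 < a ^ 2 / (b + 1) ^ 2 := by positivity
  nlinarith

theorem apply_perp (hT : ∀ u v, B (T u) v = B u (T v)) {N : Submodule ℝ E}
    (inv : ∀ u ∈ N, T u ∈ N) {v : E} (hv : ∀ u ∈ N, B v u = 0) : ∀ u ∈ N, B (T v) u = 0 :=
  fun u hu => by rw [hT, hv _ (inv u hu)]

theorem OrthonormalUpTo.of_unit (ho : ∀ i j : Fin n, (i : ℕ) < p → (j : ℕ) < p → i ≠ j →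
    B (ξ i) (ξ j) = 0) (hu : ∀ i : Fin n, (i : ℕ) < p → B (ξ i) (ξ i) = 1) :
    OrthonormalUpTo B ξ p := by
  intro i j hi hj
  split_ifs with h
  · rw [← h, hu i hi]
  · exact ho i j hi hj h

theorem FramedType.exists_neg {k : Fin n} (h : FramedType B T ξ (k + 1)) (hB : IsInner B) :
    ∃ P : Submodule ℝ E, finrank ℝ P = k ∧ ∀ v ∈ P, v ≠ 0 → B (T v) v < 0 := by
  refine ⟨flag ξ k, (h.orth.mono (Nat.le_succ _)).finrank_flag k.2.le, fun v hv hv0 => ?_⟩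
  have hv' := flag_mono (Nat.le_succ _) hv
  refine lt_of_le_of_ne (h.nonpos v hv') fun h0 => hv0 (hB.eq_zero ?_)
  exact perp_flag (fun i hi => h.null v hv' h0 i (by omega)) v hv

variable [FiniteDimensional ℝ E]

/-- On the orthogonal complement of the negative eigenspace, null vectors lie in the kernel. -/
theorem apply_eq_zero_of_perp_negEigen (hB : IsInner B) (hT : ∀ u v, B (T u) v = B u (T v)) {v : E}
    (hv : ∀ u ∈ negEigen T, B v u = 0) (h0 : B (T v) v = 0) : T v = 0 := by
  obtain ⟨P, -, hP⟩ := hB.finrank_orthogonal (negEigen T)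
  exact apply_eq_zero_of_form_eq_zero hB hT (N := P)
    (fun u hu => (hP _).2 (apply_perp hT (fun _ => negEigen_invariant) ((hP u).1 hu)))
    (fun u hu => (negEigen_sign hB hT).2 u ((hP u).1 hu)) ((hP v).2 hv) h0

/-- The kernel is orthogonal to the negative eigenspace. -/
theorem perp_negEigen_of_apply_eq_zero (hB : IsInner B) (hT : ∀ u v, B (T u) v = B u (T v)) {v : E}
    (hv : T v = 0) : ∀ u ∈ negEigen T, B v u = 0 := by
  obtain ⟨u, hu, w, rfl, hw⟩ := hB.exists_decomp (negEigen T) v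
  have h1 : B (T u) u = 0 := by
    have h := apply_perp hT (fun _ => negEigen_invariant) hw u hu
    have h2 : B (T (u + w)) u = 0 := by rw [hv]; simp
    rw [map_add, map_add, LinearMap.add_apply, h, add_zero] at h2
    exact h2
  have hu0 : u = 0 := by
    by_contra h
    linarith [(negEigen_sign hB hT).1 u hu h]
  simpa [hu0] using hw

/-- An invertible operator whose negative eigenspace is framed is in normal form. -/
theorem framedType_of_regular (hB : IsInner B) (hT : ∀ u v, B (T u) v = B u (T v))
    (hn : finrank ℝ E = n) (hr : finrank ℝ (LinearMap.range T) = n)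
    (ho : OrthonormalUpTo B ξ p) (hp : p = finrank ℝ (negEigen T))
    (hspan : flag ξ p = negEigen T) : FramedType B T ξ p := by
  obtain ⟨hneg, hnonneg⟩ := negEigen_sign hB hT
  have hker : ∀ v, T v = 0 → v = 0 := by
    have h := T.finrank_range_add_finrank_ker
    have h' : finrank ℝ (LinearMap.ker T) = 0 := by omega
    rw [Submodule.finrank_eq_zero] at h'
    intro v hv
    have : v ∈ LinearMap.ker T := hv
    rwa [h', Submodule.mem_bot] at this
  refine ⟨?_, ho, ?_, ?_, ?_, ?_⟩
  · rw [hp, ← hn]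
    exact Submodule.finrank_le _
  · intro i hi
    rw [hspan]
    exact negEigen_invariant (hspan ▸ mem_flag hi)
  · intro v hv0 hv
    have hv' := perp_flag hv
    rw [hspan] at hv'
    refine lt_of_le_of_ne (hnonneg v hv') fun h => hv0 ?_
    exact hker v (apply_eq_zero_of_perp_negEigen hB hT hv' h.symm)
  · intro v hv
    rw [hspan] at hv
    by_cases h : v = 0
    · simp [h]
    · exact (hneg v hv h).le
  · intro v hv h0 i _
    rw [hspan] at hv
    by_cases h : v = 0
    · simp [h]
    · exact absurd h0 (hneg v hv h).ne

theorem finrank_negEigen_lt (hB : IsInner B) (hT : ∀ u v, B (T u) v = B u (T v))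
    (hn : finrank ℝ E = n) (hr : finrank ℝ (LinearMap.range T) + 1 = n) :
    finrank ℝ (negEigen T) < n := by
  have hd : Disjoint (negEigen T) (LinearMap.ker T) := by
    rw [Submodule.disjoint_def]
    intro v hv hk
    exact hB.eq_zero (perp_negEigen_of_apply_eq_zero hB hT hk v hv)
  have h1 := Submodule.finrank_add_finrank_le_of_disjoint hd
  have h2 := T.finrank_range_add_finrank_ker
  omega

/-- An operator with a one-dimensional kernel is in normal form if the negative eigenspace is framed
and the next vector spans the kernel. -/
theorem framedType_of_singular (hB : IsInner B) (hT : ∀ u v, B (T u) v = B u (T v))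
    (hn : finrank ℝ E = n) (hr : finrank ℝ (LinearMap.range T) + 1 = n) {k : Fin n}
    (ho : OrthonormalUpTo B ξ k) (hspan : flag ξ k = negEigen T) (hk0 : T (ξ k) = 0)
    (hk1 : B (ξ k) (ξ k) = 1) : FramedType B T ξ (k + 1) := by
  obtain ⟨hneg, hnonneg⟩ := negEigen_sign hB hT
  have hkp := perp_negEigen_of_apply_eq_zero hB hT hk0
  have hkf : ∀ i : Fin n, (i : ℕ) < k → B (ξ k) (ξ i) = 0 :=
    fun i hi => hkp _ (hspan ▸ mem_flag hi)
  have hker : ∀ v, T v = 0 → B v (ξ k) = 0 → v = 0 := by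
    intro v hv hvk
    have h := T.finrank_range_add_finrank_ker
    have h' : finrank ℝ (LinearMap.ker T) = 1 := by omega
    have hne : (⟨ξ k, hk0⟩ : LinearMap.ker T) ≠ 0 := by
      intro h
      have : ξ k = 0 := congrArg Subtype.val h
      simp [this] at hk1
    obtain ⟨c, hc⟩ := (finrank_eq_one_iff_of_nonzero' _ hne).1 h' ⟨v, hv⟩
    have hc' : c • ξ k = v := congrArg Subtype.val hc
    rw [← hc'] at hvk ⊢
    simp only [map_smul, LinearMap.smul_apply, smul_eq_mul, hk1, mul_one] at hvk
    rw [hvk, zero_smul]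
  have hform : ∀ u ∈ flag ξ k, ∀ β : ℝ, B (T (u + β • ξ k)) (u + β • ξ k) = B (T u) u := by
    intro u hu β
    have : B (T u) (ξ k) = 0 := by rw [hT, hk0, map_zero]
    simp [hk0, this]
  refine ⟨k.2, ?_, ?_, ?_, ?_, ?_⟩
  · refine OrthonormalUpTo.of_unit ?_ ?_
    · intro i j hi hj hij
      rcases Nat.lt_succ_iff_lt_or_eq.1 hi with hi' | hi' <;>
        rcases Nat.lt_succ_iff_lt_or_eq.1 hj with hj' | hj'
      · rw [ho i j hi' hj', if_neg hij]
      · rw [Fin.ext hj', hB.symm, hkf i hi']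
      · rw [Fin.ext hi', hkf j hj']
      · exact absurd (Fin.ext (hi'.trans hj'.symm)) hij
    · intro i hi
      rcases Nat.lt_succ_iff_lt_or_eq.1 hi with hi' | hi'
      · rw [ho i i hi' hi', if_pos rfl]
      · rw [Fin.ext hi', hk1]
  · intro i hi
    rcases Nat.lt_succ_iff_lt_or_eq.1 hi with hi' | hi'
    · refine flag_mono (Nat.le_succ _) ?_
      rw [hspan]
      exact negEigen_invariant (hspan ▸ mem_flag hi')
    · rw [Fin.ext hi', hk0]
      exact zero_mem _
  · intro v hv0 hv
    have hv' := perp_flag (p := k) fun i hi => hv i (hi.trans (Nat.lt_succ_self _))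
    rw [hspan] at hv'
    refine lt_of_le_of_ne (hnonneg v hv') fun h => hv0 ?_
    exact hker v (apply_eq_zero_of_perp_negEigen hB hT hv' h.symm) (hv k (Nat.lt_succ_self _))
  · intro v hv
    obtain ⟨u, hu, β, rfl⟩ := exists_of_mem_flag_succ hv
    rw [hform u hu]
    by_cases h : u = 0
    · simp [h]
    · exact (hneg u (hspan ▸ hu) h).le
  · intro v hv h0 i hi
    obtain ⟨u, hu, β, rfl⟩ := exists_of_mem_flag_succ hv
    rw [hform u hu] at h0
    have hu0 : u = 0 := by
      by_contra h
      exact (hneg u (hspan ▸ hu) h).ne h0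
    simp [hu0, hkf i (by omega)]

/-- The two cases of the normal form. -/
theorem FramedType.cases (h : FramedType B T ξ p) (hB : IsInner B)
    (hT : ∀ u v, B (T u) v = B u (T v)) (hn : finrank ℝ E = n) :
    (negEigen T = flag ξ p ∧ finrank ℝ (LinearMap.range T) = n) ∨
      ∃ k : Fin n, (k : ℕ) + 1 = p ∧ T (ξ k) = 0 ∧ negEigen T = flag ξ k ∧
        finrank ℝ (LinearMap.range T) + 1 = n := by
  have hinv := flag_invariant h.inv
  have hnull : ∀ v ∈ flag ξ p, B (T v) v = 0 → T v = 0 := by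
    intro v hv h0
    have := apply_eq_zero_of_form_eq_zero (T := -T) (N := flag ξ p) hB (by simpa using hT)
      (fun u hu => by simpa using hinv u hu) (fun u hu => by simpa using h.nonpos u hu) hv
      (by simpa using h0)
    simpa using this
  have hker : ∀ v, T v = 0 → v ∈ flag ξ p := by
    intro v hv
    obtain ⟨u, hu, w, rfl, hw⟩ := hB.exists_decomp (flag ξ p) v
    have h1 : B (T w) w = 0 := by
      have h2 : B (T (u + w)) w = 0 := by rw [hv]; simp
      rw [map_add, map_add, LinearMap.add_apply, hB.symm (T u), hw _ (hinv u hu), zero_add] at h2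
      exact h2
    have hw0 : w = 0 := by
      by_contra h'
      exact (h.pos w h' fun i hi => hw _ (mem_flag hi)).ne' h1
    simpa [hw0] using hu
  have hrk := T.finrank_range_add_finrank_ker
  by_cases hreg : ∀ v ∈ flag ξ p, B (T v) v = 0 → v = 0
  · left
    constructor
    · refine negEigen_eq hB hT hinv ?_ ?_
      · intro u hu hu0
        exact lt_of_le_of_ne (h.nonpos u hu) fun h' => hu0 (hreg u hu h')
      · intro v hv
        by_cases hv0 : v = 0
        · simp [hv0]
        · exact (h.pos v hv0 fun i hi => hv _ (mem_flag hi)).le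
    · have : LinearMap.ker T = ⊥ := by
        refine (Submodule.eq_bot_iff _).2 fun v hv => hreg v (hker v hv) ?_
        rw [LinearMap.mem_ker.1 hv]
        simp
      rw [this, finrank_bot] at hrk
      omega
  · right
    push Not at hreg
    obtain ⟨v, hv, h0, hv0⟩ := hreg
    have hp : p ≠ 0 := by
      rintro rfl
      apply hv0
      simpa [flag] using hv
    obtain ⟨q, rfl⟩ := Nat.exists_eq_succ_of_ne_zero hp
    set k : Fin n := ⟨q, h.le⟩
    -- a null vector of the form is a multiple of the last frame vector
    have hlast : ∀ v ∈ flag ξ (q + 1), B (T v) v = 0 → ∃ β : ℝ, v = β • ξ k := by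
      intro v hv h0
      obtain ⟨u, hu, β, rfl⟩ := exists_of_mem_flag_succ (k := k) hv
      have hkp := h.orth.perp (k := k)
      have : u = 0 := by
        apply hB.eq_zero
        refine perp_flag (p := q) (fun i hi => ?_) u hu
        have h1 := h.null _ hv h0 i (by omega)
        simpa [hkp _ (mem_flag hi)] using h1
      exact ⟨β, by simp [this]⟩
    obtain ⟨β, rfl⟩ := hlast v hv h0
    have hβ : β ≠ 0 := by
      rintro rfl
      simp at hv0
    have hk0 : T (ξ k) = 0 := by
      have := hnull _ hv h0
      rw [map_smul] at this
      exact (smul_eq_zero.1 this).resolve_left hβ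
    have hk1 : B (ξ k) (ξ k) = 1 := by
      simpa using h.orth k k (Nat.lt_succ_self _) (Nat.lt_succ_self _)
    have hkne : ξ k ≠ 0 := by
      intro h
      simp [h] at hk1
    refine ⟨k, rfl, hk0, ?_, ?_⟩
    · refine negEigen_eq hB hT ?_ ?_ ?_
      · refine flag_invariant fun i hi => ?_
        refine h.orth.mem_flag_of_perp hB (h.inv i (hi.trans (Nat.lt_succ_self _))) ?_
        rw [hT, hk0, map_zero]
      · intro u hu hu0
        refine lt_of_le_of_ne (h.nonpos u (flag_mono (Nat.le_succ _) hu)) fun h' => hu0 ?_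
        obtain ⟨γ, rfl⟩ := hlast u (flag_mono (Nat.le_succ _) hu) h'
        have := h.orth.perp (k := k) _ hu
        simp only [map_smul, smul_eq_mul, hk1, mul_one] at this
        rw [this, zero_smul]
      · intro v hv
        have e1 : B (T (ξ k)) v = 0 := by rw [hk0]; simp
        have e2 : B (T v) (ξ k) = 0 := by rw [hT, hk0, map_zero]
        by_cases hw : v - B v (ξ k) • ξ k = 0
        · rw [sub_eq_zero.1 hw, map_smul T, hk0]
          simp
        · refine le_of_lt ?_
          have := h.pos _ hw fun i hi => ?_
          · simpa [hk0, e2] using this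
          · rcases Nat.lt_succ_iff_lt_or_eq.1 hi with hi' | hi'
            · have := h.orth.perp (k := k) _ (mem_flag hi')
              simp [hv _ (mem_flag hi'), this]
            · rw [show i = k from Fin.ext hi']
              simp [hk1]
    · have : LinearMap.ker T = Submodule.span ℝ {ξ k} := by
        refine le_antisymm (fun v hv => ?_) ?_
        · obtain ⟨β, rfl⟩ := hlast v (hker v hv) (by rw [LinearMap.mem_ker.1 hv]; simp)
          exact Submodule.smul_mem _ _ (Submodule.mem_span_singleton_self _)
        · rw [Submodule.span_singleton_le_iff_mem]
          exact hk0
      rw [this, finrank_span_singleton hkne] at hrk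
      omega

theorem finrank_le_negEigen (hB : IsInner B) (hT : ∀ u v, B (T u) v = B u (T v))
    {P : Submodule ℝ E} (hP : ∀ v ∈ P, v ≠ 0 → B (T v) v < 0) :
    finrank ℝ P ≤ finrank ℝ (negEigen T) := by
  obtain ⟨Q, hQ, hQ'⟩ := hB.finrank_orthogonal (negEigen T)
  have hd : Disjoint P Q := by
    rw [Submodule.disjoint_def]
    intro v hv hvQ
    by_contra h
    linarith [hP v hv h, (negEigen_sign hB hT).2 v ((hQ' v).1 hvQ)]
  have := Submodule.finrank_add_finrank_le_of_disjoint hd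
  omega

/-- A positive definite subspace has dimension at most `n - p`. With `FramedType.exists_pos` this
characterizes `p` by an open condition. -/
theorem FramedType.finrank_add_le (h : FramedType B T ξ p) (hn : finrank ℝ E = n)
    {P : Submodule ℝ E} (hP : ∀ v ∈ P, v ≠ 0 → 0 < B (T v) v) : finrank ℝ P + p ≤ n := by
  have hd : Disjoint P (flag ξ p) := by
    rw [Submodule.disjoint_def]
    intro v hv hvQ
    by_contra h'
    linarith [hP v hv h', h.nonpos v hvQ]
  have := Submodule.finrank_add_finrank_le_of_disjoint hd
  rwa [h.orth.finrank_flag h.le, hn] at this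

theorem FramedType.exists_pos (h : FramedType B T ξ p) (hB : IsInner B) (hn : finrank ℝ E = n) :
    ∃ P : Submodule ℝ E, finrank ℝ P + p = n ∧ ∀ v ∈ P, v ≠ 0 → 0 < B (T v) v := by
  obtain ⟨Q, hQ, hQ'⟩ := hB.finrank_orthogonal (flag ξ p)
  rw [h.orth.finrank_flag h.le, hn] at hQ
  exact ⟨Q, by omega, fun v hv hv0 => h.pos v hv0 fun i hi => (hQ' v).1 hv _ (mem_flag hi)⟩

end NormalForm

/-! ### Sections of class `C^r` along a subset -/

section SmoothAlong

variable {n d : ℕ} {W : Type*} [TopologicalSpace W]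
  [ChartedSpace (EuclideanSpace ℝ (Fin d)) W] {r : ℕ∞} {S S' : Set W}

/-- The real function `f` is of class `C^r` along the subset `S`: near each point of `S` it agrees
on `S` with a `C^r` function defined on an open set. -/
def FunSmoothAlong (r : ℕ∞) (S : Set W) (f : W → ℝ) : Prop :=
  ∀ x₀ ∈ S, ∃ N : Set W, IsOpen N ∧ x₀ ∈ N ∧ ∃ f' : W → ℝ,
    ContMDiffOn (𝓡 d) 𝓘(ℝ, ℝ) r f' N ∧ ∀ x ∈ S ∩ N, f' x = f x

namespace FunSmoothAlong

variable {f h : W → ℝ}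

theorem of_contMDiffOn {U : Set W} (hU : IsOpen U) (hSU : S ⊆ U)
    (hf : ContMDiffOn (𝓡 d) 𝓘(ℝ, ℝ) r f U) : FunSmoothAlong (d := d) r S f :=
  fun _ hx₀ => ⟨U, hU, hSU hx₀, f, hf, fun _ _ => rfl⟩

theorem mono (hf : FunSmoothAlong (d := d) r S f) (hS : S' ⊆ S) :
    FunSmoothAlong (d := d) r S' f := fun x₀ hx₀ =>
  let ⟨N, hN, hx, f', hf', he⟩ := hf x₀ (hS hx₀)
  ⟨N, hN, hx, f', hf', fun x hx => he x ⟨hS hx.1, hx.2⟩⟩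

theorem mul (hf : FunSmoothAlong (d := d) r S f) (hh : FunSmoothAlong (d := d) r S h) :
    FunSmoothAlong (d := d) r S fun x => f x * h x := fun x₀ hx₀ =>
  let ⟨N, hN, hx, f', hf', he⟩ := hf x₀ hx₀
  let ⟨M, hM, hx', h', hh', he'⟩ := hh x₀ hx₀
  ⟨N ∩ M, hN.inter hM, ⟨hx, hx'⟩, fun x => f' x * h' x,
    (hf'.mono inter_subset_left).mul (hh'.mono inter_subset_right),
    fun x hx => by beta_reduce; rw [he x ⟨hx.1, hx.2.1⟩, he' x ⟨hx.1, hx.2.2⟩]⟩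

theorem sub (hf : FunSmoothAlong (d := d) r S f) (hh : FunSmoothAlong (d := d) r S h) :
    FunSmoothAlong (d := d) r S fun x => f x - h x := fun x₀ hx₀ =>
  let ⟨N, hN, hx, f', hf', he⟩ := hf x₀ hx₀
  let ⟨M, hM, hx', h', hh', he'⟩ := hh x₀ hx₀
  ⟨N ∩ M, hN.inter hM, ⟨hx, hx'⟩, fun x => f' x - h' x,
    (hf'.mono inter_subset_left).sub (hh'.mono inter_subset_right),
    fun x hx => by beta_reduce; rw [he x ⟨hx.1, hx.2.1⟩, he' x ⟨hx.1, hx.2.2⟩]⟩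

theorem congr (hf : FunSmoothAlong (d := d) r S f) (he : ∀ x ∈ S, f x = h x) :
    FunSmoothAlong (d := d) r S h := fun x₀ hx₀ =>
  let ⟨N, hN, hx, f', hf', he'⟩ := hf x₀ hx₀
  ⟨N, hN, hx, f', hf', fun x hx => (he' x hx).trans (he x hx.1)⟩

theorem const (c : ℝ) : FunSmoothAlong (d := d) r S fun _ => c :=
  of_contMDiffOn isOpen_univ (subset_univ _) contMDiffOn_const

theorem comp {φ : ℝ → ℝ} {I : Set ℝ} (hI : IsOpen I) (hφ : ContDiffOn ℝ r φ I)
    (hf : FunSmoothAlong (d := d) r S f) (hfI : ∀ x ∈ S, f x ∈ I) :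
    FunSmoothAlong (d := d) r S fun x => φ (f x) := fun x₀ hx₀ =>
  let ⟨N, hN, hx, f', hf', he⟩ := hf x₀ hx₀
  ⟨N ∩ f' ⁻¹' I, hf'.continuousOn.isOpen_inter_preimage hN hI,
    ⟨hx, by rw [mem_preimage, he x₀ ⟨hx₀, hx⟩]; exact hfI x₀ hx₀⟩, fun x => φ (f' x),
    hφ.contMDiffOn.comp (hf'.mono inter_subset_left) inter_subset_right,
    fun x hx => by beta_reduce; rw [he x ⟨hx.1, hx.2.1⟩]⟩

theorem continuousOn (hf : FunSmoothAlong (d := d) r S f) : ContinuousOn f S := by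
  intro x₀ hx₀
  obtain ⟨N, hN, hx, f', hf', he⟩ := hf x₀ hx₀
  have h1 := ((hf'.continuousOn).continuousAt (hN.mem_nhds hx)).continuousWithinAt (s := S)
  refine h1.congr_of_eventuallyEq ?_ (he x₀ ⟨hx₀, hx⟩).symm
  filter_upwards [self_mem_nhdsWithin, mem_nhdsWithin_of_mem_nhds (hN.mem_nhds hx)] with x h1 h2
  exact (he x ⟨h1, h2⟩).symm

end FunSmoothAlong

variable [IsManifold (𝓡 d) ∞ W]

namespace SmoothAlong

variable {X Y : ∀ x : W, TangentSpace (𝓡 d) x} {f : W → ℝ}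

theorem of_contMDiffOn {U : Set W} (hU : IsOpen U) (hSU : S ⊆ U)
    (hX : ContMDiffOn (𝓡 d) (𝓡 d).tangent r (fun x => (⟨x, X x⟩ : TangentBundle (𝓡 d) W)) U) :
    SmoothAlong r S X :=
  fun _ hx₀ => ⟨U, hU, hSU hx₀, X, hX, fun _ _ => rfl⟩

theorem mono (hX : SmoothAlong r S X) (hS : S' ⊆ S) : SmoothAlong r S' X := fun x₀ hx₀ =>
  let ⟨N, hN, hx, X', hX', he⟩ := hX x₀ (hS hx₀)
  ⟨N, hN, hx, X', hX', fun x hx => he x ⟨hS hx.1, hx.2⟩⟩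

theorem congr (hX : SmoothAlong r S X) (h : ∀ x ∈ S, X x = Y x) : SmoothAlong r S Y :=
  fun x₀ hx₀ =>
  let ⟨N, hN, hx, X', hX', he⟩ := hX x₀ hx₀
  ⟨N, hN, hx, X', hX', fun x hx => (he x hx).trans (h x hx.1)⟩

theorem of_nhds (h : ∀ x₀ ∈ S, ∃ N : Set W, IsOpen N ∧ x₀ ∈ N ∧ SmoothAlong r (S ∩ N) X) :
    SmoothAlong r S X := fun x₀ hx₀ =>
  let ⟨M, hM, hxM, hX⟩ := h x₀ hx₀
  let ⟨N, hN, hx, X', hX', he⟩ := hX x₀ ⟨hx₀, hxM⟩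
  ⟨N ∩ M, hN.inter hM, ⟨hx, hxM⟩, X', hX'.mono inter_subset_left,
    fun x hx => he x ⟨⟨hx.1, hx.2.2⟩, hx.2.1⟩⟩

theorem add (hX : SmoothAlong r S X) (hY : SmoothAlong r S Y) :
    SmoothAlong r S fun x => X x + Y x := fun x₀ hx₀ =>
  let ⟨N, hN, hx, X', hX', he⟩ := hX x₀ hx₀
  let ⟨M, hM, hx', Y', hY', he'⟩ := hY x₀ hx₀
  ⟨N ∩ M, hN.inter hM, ⟨hx, hx'⟩, fun x => X' x + Y' x,
    (hX'.mono inter_subset_left).add_section (hY'.mono inter_subset_right),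
    fun x hx => by beta_reduce; rw [he x ⟨hx.1, hx.2.1⟩, he' x ⟨hx.1, hx.2.2⟩]⟩

theorem smul (hf : FunSmoothAlong (d := d) r S f) (hY : SmoothAlong r S Y) :
    SmoothAlong r S fun x => f x • Y x := fun x₀ hx₀ =>
  let ⟨N, hN, hx, f', hf', he⟩ := hf x₀ hx₀
  let ⟨M, hM, hx', Y', hY', he'⟩ := hY x₀ hx₀
  ⟨N ∩ M, hN.inter hM, ⟨hx, hx'⟩, fun x => f' x • Y' x,
    (hf'.mono inter_subset_left).smul_section (hY'.mono inter_subset_right),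
    fun x hx => by beta_reduce; rw [he x ⟨hx.1, hx.2.1⟩, he' x ⟨hx.1, hx.2.2⟩]⟩

theorem sub (hX : SmoothAlong r S X) (hY : SmoothAlong r S Y) :
    SmoothAlong r S fun x => X x - Y x :=
  (hX.add (smul (FunSmoothAlong.const (-1)) hY)).congr fun x _ => by
    rw [neg_one_smul, sub_eq_add_neg]

theorem zero : SmoothAlong r S fun x : W => (0 : TangentSpace (𝓡 d) x) :=
  of_contMDiffOn isOpen_univ (subset_univ _)
    (Bundle.contMDiff_zeroSection ℝ (TangentSpace (𝓡 d) : W → Type _)).contMDiffOn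

theorem sum {ι : Type*} (t : Finset ι) {X : ι → ∀ x : W, TangentSpace (𝓡 d) x}
    (h : ∀ i ∈ t, SmoothAlong r S (X i)) : SmoothAlong r S fun x => ∑ i ∈ t, X i x := by
  classical
  induction t using Finset.induction_on with
  | empty => simpa using zero
  | insert i s hi ih =>
    simp only [Finset.sum_insert hi]
    exact (h i (Finset.mem_insert_self _ _)).add
      (ih fun j hj => h j (Finset.mem_insert_of_mem hj))

end SmoothAlong

theorem contMDiffOn_inner (g : Metric d W) {X Y : ∀ x : W, TangentSpace (𝓡 d) x} {N : Set W}
    (hX : ContMDiffOn (𝓡 d) (𝓡 d).tangent r (fun x => (⟨x, X x⟩ : TangentBundle (𝓡 d) W)) N)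
    (hY : ContMDiffOn (𝓡 d) (𝓡 d).tangent r (fun x => (⟨x, Y x⟩ : TangentBundle (𝓡 d) W)) N) :
    ContMDiffOn (𝓡 d) 𝓘(ℝ, ℝ) r (fun x => g.inner x (X x) (Y x)) N := by
  intro x hx
  have : ContMDiffWithinAt (𝓡 d) ((𝓡 d).prod 𝓘(ℝ)) r
      (fun m ↦ Bundle.TotalSpace.mk' ℝ (E := Bundle.Trivial W ℝ) m (g.inner m (X m) (Y m))) N x :=
    ContMDiffWithinAt.clm_bundle_apply₂ (F₁ := EuclideanSpace ℝ (Fin d))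
      (F₂ := EuclideanSpace ℝ (Fin d))
      ((g.contMDiff.of_le (by exact_mod_cast le_top)).contMDiffAt.contMDiffWithinAt)
      (hX x hx) (hY x hx)
  simp only [Bundle.contMDiffWithinAt_totalSpace] at this
  exact this.2

theorem SmoothAlong.inner (g : Metric d W) {X Y : ∀ x : W, TangentSpace (𝓡 d) x}
    (hX : SmoothAlong r S X) (hY : SmoothAlong r S Y) :
    FunSmoothAlong (d := d) r S fun x => g.inner x (X x) (Y x) := fun x₀ hx₀ =>
  let ⟨N, hN, hx, X', hX', he⟩ := hX x₀ hx₀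
  let ⟨M, hM, hx', Y', hY', he'⟩ := hY x₀ hx₀
  ⟨N ∩ M, hN.inter hM, ⟨hx, hx'⟩, fun x => g.inner x (X' x) (Y' x),
    contMDiffOn_inner g (hX'.mono inter_subset_left) (hY'.mono inter_subset_right),
    fun x hx => by beta_reduce; rw [he x ⟨hx.1, hx.2.1⟩, he' x ⟨hx.1, hx.2.2⟩]⟩

/-- The metric on the fibres of the plane field. -/
noncomputable def ip (g : Metric d W) (ζ : PlaneField n d W) (x : W) :
    LinearMap.BilinForm ℝ (ζ.fiber x) :=
  LinearMap.mk₂ ℝ (fun u v => g.inner x (u : TangentSpace (𝓡 d) x) (v : TangentSpace (𝓡 d) x))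
    (fun u u' v => by simp) (fun c u v => by simp) (fun u v v' => by simp) (fun c u v => by simp)

theorem ip_apply (g : Metric d W) (ζ : PlaneField n d W) (x : W) (u v : ζ.fiber x) :
    ip g ζ x u v = g.inner x (u : TangentSpace (𝓡 d) x) (v : TangentSpace (𝓡 d) x) := rfl

theorem isInner_ip (g : Metric d W) (ζ : PlaneField n d W) (x : W) : IsInner (ip g ζ x) where
  symm u v := g.symm x u v
  pos v hv := g.pos x v fun h => hv (Subtype.ext h)

instance (ζ : PlaneField n d W) (x : W) : FiniteDimensional ℝ (ζ.fiber x) :=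
  have : FiniteDimensional ℝ (TangentSpace (𝓡 d) x) :=
    inferInstanceAs (FiniteDimensional ℝ (EuclideanSpace ℝ (Fin d)))
  inferInstance

end SmoothAlong

/-! ### Extension of sections of a plane field -/

section Extension

variable {n d : ℕ} {W : Type*} [TopologicalSpace W]
  [ChartedSpace (EuclideanSpace ℝ (Fin d)) W] {r : ℕ∞} {S : Set W}

theorem contMDiffOn_det {N : Set W} {G : W → Matrix (Fin n) (Fin n) ℝ}
    (hG : ∀ i j, ContMDiffOn (𝓡 d) 𝓘(ℝ, ℝ) r (fun x => G x i j) N) :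
    ContMDiffOn (𝓡 d) 𝓘(ℝ, ℝ) r (fun x => (G x).det) N := by
  simp only [Matrix.det_apply']
  refine contMDiffOn_finsetSum fun σ _ => ?_
  exact contMDiffOn_const.mul (contMDiffOn_finsetProd fun i _ => hG _ _)

variable [IsManifold (𝓡 d) ∞ W]

/-- The local frames of a plane field, as sections of the plane field. -/
theorem PlaneField.exists_linearIndependent_frame (ζ : PlaneField n d W) (x₀ : W) :
    ∃ N : Set W, IsOpen N ∧ x₀ ∈ N ∧ ∃ s : Fin n → ∀ x, ζ.fiber x,
      (∀ i, ContMDiffOn (𝓡 d) (𝓡 d).tangent ∞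
        (fun x => (⟨x, (s i x : TangentSpace (𝓡 d) x)⟩ : TangentBundle (𝓡 d) W)) N) ∧
      ∀ x ∈ N, LinearIndependent ℝ (fun i => s i x) ∧
        Submodule.span ℝ (range fun i => s i x) = ⊤ := by
  classical
  obtain ⟨N, hN, hx₀, s, hs, hspan⟩ := ζ.exists_frame x₀
  have hmem : ∀ x ∈ N, ∀ i, s i x ∈ ζ.fiber x := fun x hx i => by
    rw [← hspan x hx]
    exact Submodule.subset_span (mem_range_self i)
  let s' : Fin n → ∀ x, ζ.fiber x := fun i x =>
    if h : s i x ∈ ζ.fiber x then ⟨s i x, h⟩ else 0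
  have hs' : ∀ x ∈ N, ∀ i, (s' i x : TangentSpace (𝓡 d) x) = s i x := fun x hx i => by
    simp [s', hmem x hx i]
  refine ⟨N, hN, hx₀, s', fun i => (hs i).congr fun x hx => by rw [hs' x hx i],
    fun x hx => ?_⟩
  have htop : Submodule.span ℝ (range fun i => s' i x) = ⊤ := by
    apply Submodule.map_injective_of_injective (ζ.fiber x).injective_subtype
    rw [Submodule.map_span, ← range_comp, Submodule.map_top, Submodule.range_subtype]
    refine Eq.trans ?_ (hspan x hx)
    congr 2
    funext i
    exact hs' x hx i
  exact ⟨linearIndependent_of_top_le_span_of_card_eq_finrank htop.ge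
    (by rw [ζ.finrank_fiber, Fintype.card_fin]), htop⟩

/-- A section of the plane field that is of class `C^r` along a subset has local `C^r` extensions
that are tangent to the plane field: project an arbitrary local extension orthogonally, using the
Gram matrix of a local frame and Cramer's rule. -/
theorem exists_local_extension (g : Metric d W) (ζ : PlaneField n d W) {X : ∀ x, ζ.fiber x}
    (hX : SmoothAlong r S fun x => (X x : TangentSpace (𝓡 d) x)) {x₀ : W} (hx₀ : x₀ ∈ S) :
    ∃ N : Set W, IsOpen N ∧ x₀ ∈ N ∧ ∃ Y : ∀ x, ζ.fiber x,
      ContMDiffOn (𝓡 d) (𝓡 d).tangent r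
        (fun x => (⟨x, (Y x : TangentSpace (𝓡 d) x)⟩ : TangentBundle (𝓡 d) W)) N ∧
      ∀ x ∈ S ∩ N, Y x = X x := by
  obtain ⟨N₁, hN₁, hx₁, Z, hZ, hZX⟩ := hX x₀ hx₀
  obtain ⟨N₂, hN₂, hx₂, s, hs, hfr⟩ := ζ.exists_linearIndependent_frame x₀
  have hs' : ∀ i, ContMDiffOn (𝓡 d) (𝓡 d).tangent r
      (fun x => (⟨x, (s i x : TangentSpace (𝓡 d) x)⟩ : TangentBundle (𝓡 d) W)) N₂ :=
    fun i => (hs i).of_le (by exact_mod_cast le_top)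
  let G : W → Matrix (Fin n) (Fin n) ℝ := fun x i j =>
    g.inner x (s i x : TangentSpace (𝓡 d) x) (s j x : TangentSpace (𝓡 d) x)
  let b : W → Fin n → ℝ := fun x i => g.inner x (s i x : TangentSpace (𝓡 d) x) (Z x)
  have hG : ∀ i j, ContMDiffOn (𝓡 d) 𝓘(ℝ, ℝ) r (fun x => G x i j) N₂ :=
    fun i j => contMDiffOn_inner g (hs' i) (hs' j)
  have hb : ∀ i, ContMDiffOn (𝓡 d) 𝓘(ℝ, ℝ) r (fun x => b x i) (N₁ ∩ N₂) := fun i =>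
    contMDiffOn_inner g ((hs' i).mono inter_subset_right) (hZ.mono inter_subset_left)
  have hsum : ∀ x (c : Fin n → ℝ) i, (G x).mulVec c i =
      ip g ζ x (s i x) (∑ j, c j • s j x) := by
    intro x c i
    rw [map_sum]
    simp only [map_smul, smul_eq_mul, Matrix.mulVec, dotProduct]
    exact Finset.sum_congr rfl fun j _ => mul_comm _ _
  have hdet : ∀ x ∈ N₂, (G x).det ≠ 0 := by
    intro x hx h0
    obtain ⟨c, hc, h⟩ := Matrix.exists_mulVec_eq_zero_iff.2 h0
    apply hc
    have hv : ∑ j, c j • s j x = 0 := by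
      apply (isInner_ip g ζ x).eq_zero
      conv_lhs => enter [1]; rw [map_sum]
      rw [LinearMap.sum_apply]
      refine Finset.sum_eq_zero fun i _ => ?_
      rw [map_smul, LinearMap.smul_apply, ← hsum, h]
      simp
    funext j
    exact Fintype.linearIndependent_iff.1 (hfr x hx).1 c hv j
  refine ⟨N₁ ∩ N₂, hN₁.inter hN₂, ⟨hx₁, hx₂⟩,
    fun x => ∑ i, ((G x).det⁻¹ * ((G x).updateCol i (b x)).det) • s i x, ?_, ?_⟩
  · have : ContMDiffOn (𝓡 d) (𝓡 d).tangent r (fun x => (⟨x,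
        ∑ i, ((G x).det⁻¹ * ((G x).updateCol i (b x)).det) • (s i x : TangentSpace (𝓡 d) x)⟩ :
        TangentBundle (𝓡 d) W)) (N₁ ∩ N₂) := by
      refine ContMDiffOn.sum_section fun i _ => ContMDiffOn.smul_section ?_
        ((hs' i).mono inter_subset_right)
      refine ContMDiffOn.mul ?_ ?_
      · exact ((contMDiffOn_det hG).inv₀ hdet).mono inter_subset_right
      · refine contMDiffOn_det fun k j => ?_
        simp only [Matrix.updateCol_apply]
        split_ifs
        · exact hb k
        · exact (hG k j).mono inter_subset_right
    refine this.congr fun x _ => ?_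
    simp
  · rintro x ⟨hxS, hx₁, hx₂⟩
    have hmem : X x ∈ Submodule.span ℝ (range fun i => s i x) := by
      rw [(hfr x hx₂).2]
      trivial
    obtain ⟨c, hc⟩ := (Submodule.mem_span_range_iff_exists_fun ℝ).1 hmem
    have hbx : b x = (G x).mulVec c := by
      funext i
      rw [hsum, hc, ip_apply]
      exact congrArg (g.inner x _) (hZX x ⟨hxS, hx₁⟩)
    rw [← hc]
    refine Finset.sum_congr rfl fun i _ => ?_
    congr 1
    rw [← Matrix.cramer_apply, hbx, Matrix.cramer_eq_adjugate_mulVec, Matrix.mulVec_mulVec,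
      Matrix.adjugate_mul, Matrix.smul_mulVec, Matrix.one_mulVec, Pi.smul_apply, smul_eq_mul,
      inv_mul_cancel_left₀ (hdet x hx₂)]

variable [T2Space W] [SecondCountableTopology W]

/-- A section of the plane field that is of class `C^r` along a closed subset extends to a global
`C^r` section. -/
theorem exists_global_extension (g : Metric d W) (ζ : PlaneField n d W) (hS : IsClosed S)
    {X : ∀ x, ζ.fiber x} (hX : SmoothAlong r S fun x => (X x : TangentSpace (𝓡 d) x)) :
    ∃ Y : ∀ x, ζ.fiber x, ContMDiff (𝓡 d) (𝓡 d).tangent r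
        (fun x => (⟨x, (Y x : TangentSpace (𝓡 d) x)⟩ : TangentBundle (𝓡 d) W)) ∧
      ∀ x ∈ S, Y x = X x := by
  have : LocallyCompactSpace W := Manifold.locallyCompact_of_finiteDimensional (𝓡 d)
  let t : ∀ x : W, Set (TangentSpace (𝓡 d) x) := fun x =>
    {v | v ∈ ζ.fiber x ∧ (x ∈ S → v = X x)}
  obtain ⟨Y, hY⟩ := exists_contMDiffSection_forall_mem_convex_of_local (𝓡 d) (n := r)
    (F_fiber := EuclideanSpace ℝ (Fin d)) (fun x : W => TangentSpace (𝓡 d) x) t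
    (fun x => by
      rintro v ⟨hv, hv'⟩ w ⟨hw, hw'⟩ a b _ _ hab
      refine ⟨add_mem (Submodule.smul_mem _ _ hv) (Submodule.smul_mem _ _ hw), fun hx => ?_⟩
      rw [hv' hx, hw' hx, ← add_smul, hab, one_smul])
    (fun x₀ => by
      by_cases hx₀ : x₀ ∈ S
      · obtain ⟨N, hN, hx, Y, hY, he⟩ := exists_local_extension g ζ hX hx₀
        exact ⟨N, hN.mem_nhds hx, fun x => Y x, hY,
          fun y hy => ⟨(Y y).2, fun h => congrArg Subtype.val (he y ⟨h, hy⟩)⟩⟩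
      · exact ⟨Sᶜ, hS.isOpen_compl.mem_nhds hx₀, fun _ => 0,
          (Bundle.contMDiff_zeroSection ℝ (TangentSpace (𝓡 d) : W → Type _)).contMDiffOn,
          fun y hy => ⟨zero_mem _, fun h => absurd h hy⟩⟩)
  exact ⟨fun x => ⟨Y x, (hY x).1⟩, Y.contMDiff, fun x hx => Subtype.ext ((hY x).2 hx)⟩

/-- Near a point, a section of class `C^r` along a subset is the restriction of a global one. -/
theorem exists_global_extension_nhds (g : Metric d W) (ζ : PlaneField n d W)
    {X : ∀ x, ζ.fiber x} (hX : SmoothAlong r S fun x => (X x : TangentSpace (𝓡 d) x)) {x₀ : W}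
    (hx₀ : x₀ ∈ S) :
    ∃ N : Set W, IsOpen N ∧ x₀ ∈ N ∧ ∃ Y : ∀ x, ζ.fiber x,
      ContMDiff (𝓡 d) (𝓡 d).tangent r
        (fun x => (⟨x, (Y x : TangentSpace (𝓡 d) x)⟩ : TangentBundle (𝓡 d) W)) ∧
      ∀ x ∈ S ∩ N, Y x = X x := by
  have : LocallyCompactSpace W := Manifold.locallyCompact_of_finiteDimensional (𝓡 d)
  obtain ⟨N, hN, hx, Y, hY, he⟩ := exists_local_extension g ζ hX hx₀
  obtain ⟨K, hK, hxK, hKN⟩ := exists_compact_subset hN hx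
  obtain ⟨Z, hZ, hZY⟩ := exists_global_extension g ζ hK.isClosed
    (SmoothAlong.of_contMDiffOn hN hKN hY)
  exact ⟨interior K, isOpen_interior, hxK, Z, hZ, fun x hx => by
    rw [hZY x (interior_subset hx.2), he x ⟨hx.1, hKN (interior_subset hx.2)⟩]⟩

/-- Every vector of the plane field is the value of a global section. -/
theorem exists_global_section (g : Metric d W) (ζ : PlaneField n d W) (r : ℕ∞) (x₀ : W)
    (v : ζ.fiber x₀) :
    ∃ Y : ∀ x, ζ.fiber x, ContMDiff (𝓡 d) (𝓡 d).tangent r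
        (fun x => (⟨x, (Y x : TangentSpace (𝓡 d) x)⟩ : TangentBundle (𝓡 d) W)) ∧
      Y x₀ = v := by
  classical
  let X : ∀ x, ζ.fiber x := fun x => if h : x = x₀ then h ▸ v else 0
  have hX₀ : X x₀ = v := by simp [X]
  obtain ⟨Y, hY, he⟩ := exists_global_extension (r := r) g ζ (isClosed_singleton (x := x₀))
    (X := X) (by
      intro y hy
      rw [mem_singleton_iff] at hy
      subst hy
      obtain ⟨N, hN, hx₀, s, hs, hfr⟩ := ζ.exists_linearIndependent_frame y
      obtain ⟨c, hc⟩ := (Submodule.mem_span_range_iff_exists_fun ℝ).1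
        (show X y ∈ Submodule.span ℝ (range fun i => s i y) by rw [(hfr y hx₀).2]; trivial)
      refine ⟨N, hN, hx₀, fun x => ∑ i, c i • (s i x : TangentSpace (𝓡 d) x), ?_, ?_⟩
      · exact ContMDiffOn.sum_section fun i _ =>
          ((hs i).of_le (by exact_mod_cast le_top)).const_smul_section
      · rintro x ⟨hx, -⟩
        rw [mem_singleton_iff] at hx
        subst hx
        beta_reduce
        rw [← hc]
        simp)
  exact ⟨Y, hY, by rw [he x₀ rfl, hX₀]⟩

end Extension

/-! ### Framed operator fields and the lowering of the index -/

section FramedField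

open Module

variable {n d : ℕ} {W : Type*} [TopologicalSpace W]
  [ChartedSpace (EuclideanSpace ℝ (Fin d)) W] [IsManifold (𝓡 d) ∞ W]

/-- A field `T` of symmetric operators on the plane field along the subset `V`, with a framing `ξ`,
both of class `C^r`. The number `p x` is the sum of the index and the nullity of the operator at
`x`, so that the framing vector field number `i` is defined where `i < p x`. The kernel direction
`λ⁺` does not occur: at a singular point it is the last one of the `p x` framing vectors. -/
structure FramedField (g : Metric d W) (ζ : PlaneField n d W) (r : ℕ∞) (V : Set W)
    (T : ∀ x, ζ.fiber x →ₗ[ℝ] ζ.fiber x) (ξ : Fin n → ∀ x, ζ.fiber x) (p : W → ℕ) : Prop where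
  smooth : ∀ S ⊆ V, ∀ X : (∀ x, ζ.fiber x),
    SmoothAlong r S (fun x => (X x : TangentSpace (𝓡 d) x)) →
    SmoothAlong r S (fun x => (T x (X x) : TangentSpace (𝓡 d) x))
  symm : ∀ x ∈ V, ∀ u v, ip g ζ x (T x u) v = ip g ζ x u (T x v)
  type : ∀ x ∈ V, FramedType (ip g ζ x) (T x) (fun i => ξ i x) (p x)
  frame : ∀ i : Fin n, SmoothAlong r {x | x ∈ V ∧ (i : ℕ) < p x}
    (fun x => (ξ i x : TangentSpace (𝓡 d) x))

variable {g : Metric d W} {ζ : PlaneField n d W} {r : ℕ∞} {V : Set W}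
  {T : ∀ x, ζ.fiber x →ₗ[ℝ] ζ.fiber x} {ξ : Fin n → ∀ x, ζ.fiber x} {p : W → ℕ}

theorem FramedField.mono {V' : Set W} (F : FramedField g ζ r V T ξ p) (h : V' ⊆ V) :
    FramedField g ζ r V' T ξ p where
  smooth S hS := F.smooth S (hS.trans h)
  symm x hx := F.symm x (h hx)
  type x hx := F.type x (h hx)
  frame i := (F.frame i).mono fun _ hx => ⟨h hx.1, hx.2⟩

/-- Bending preserves smoothness along a subset. -/
theorem smoothAlong_bend {S : Set W} {X e : ∀ x, ζ.fiber x} {s c : W → ℝ}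
    (hX : SmoothAlong r S fun x => (X x : TangentSpace (𝓡 d) x))
    (hTX : SmoothAlong r S fun x => (T x (X x) : TangentSpace (𝓡 d) x))
    (he : SmoothAlong r S fun x => (e x : TangentSpace (𝓡 d) x))
    (hTe : SmoothAlong r S fun x => (T x (e x) : TangentSpace (𝓡 d) x))
    (hs : FunSmoothAlong (d := d) r S s) (hc : FunSmoothAlong (d := d) r S c) :
    SmoothAlong r S fun x =>
      (bend (ip g ζ x) (T x) (e x) (s x) (c x) (X x) : TangentSpace (𝓡 d) x) := by
  have ha := hTe.inner g he
  have heX := he.inner g hX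
  have h := (hTX.sub (SmoothAlong.smul hs ((SmoothAlong.smul heX
    (hTe.sub (SmoothAlong.smul ha he))).add
      (SmoothAlong.smul ((hTe.inner g hX).sub (ha.mul heX)) he)))).add
    (SmoothAlong.smul hc (SmoothAlong.smul heX he))
  exact h.congr fun x _ => by
    rw [bend_apply]
    simp [ip_apply]

variable [T2Space W] [SecondCountableTopology W]

/-- A subspace on which an operator field is positive definite persists nearby. -/
theorem eventually_exists_pos
    (hT : ∀ X : (∀ x, ζ.fiber x), SmoothAlong r V (fun x => (X x : TangentSpace (𝓡 d) x)) →
      SmoothAlong r V (fun x => (T x (X x) : TangentSpace (𝓡 d) x)))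
    {x₀ : W} (hx₀ : x₀ ∈ V) {P : Submodule ℝ (ζ.fiber x₀)}
    (hP : ∀ v ∈ P, v ≠ 0 → 0 < ip g ζ x₀ (T x₀ v) v) :
    ∀ᶠ x in 𝓝[V] x₀, ∃ P' : Submodule ℝ (ζ.fiber x), finrank ℝ P' = finrank ℝ P ∧
      ∀ v ∈ P', v ≠ 0 → 0 < ip g ζ x (T x v) v := by
  let b := finBasis ℝ P
  choose Y hY hYb using fun i => exists_global_section g ζ r x₀ (b i : ζ.fiber x₀)
  have hYV : ∀ i, SmoothAlong r V fun x => (Y i x : TangentSpace (𝓡 d) x) := fun i =>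
    SmoothAlong.of_contMDiffOn isOpen_univ (subset_univ _) (hY i).contMDiffOn
  -- the form on the span of the extended basis
  let Q : W → (Fin (finrank ℝ P) → ℝ) → ℝ := fun x c =>
    ∑ i, ∑ j, c i * (c j * ip g ζ x (T x (Y i x)) (Y j x))
  have hQ : ∀ x c, Q x c = ip g ζ x (T x (∑ i, c i • Y i x)) (∑ i, c i • Y i x) := by
    intro x c
    simp only [Q, map_sum, LinearMap.sum_apply, map_smul, LinearMap.smul_apply, smul_eq_mul]
    rw [Finset.sum_comm]
    exact Finset.sum_congr rfl fun i _ => by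
      rw [Finset.mul_sum]
      exact Finset.sum_congr rfl fun j _ => by ring
  have hlim : ∀ c, Filter.Tendsto (fun z : W × (Fin (finrank ℝ P) → ℝ) => Q z.1 z.2)
      (𝓝[V] x₀ ×ˢ 𝓝 c) (𝓝 (Q x₀ c)) := by
    intro c
    refine tendsto_finsetSum _ fun i _ => tendsto_finsetSum _ fun j _ => ?_
    have hc : ∀ i, Filter.Tendsto (fun z : W × (Fin (finrank ℝ P) → ℝ) => z.2 i)
        (𝓝[V] x₀ ×ˢ 𝓝 c) (𝓝 (c i)) := fun i =>
      ((continuous_apply i).tendsto c).comp Filter.tendsto_snd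
    have h1 := ((hT _ (hYV i)).inner g (hYV j)).continuousOn x₀ hx₀
    exact (hc i).mul ((hc j).mul (Filter.Tendsto.comp h1 Filter.tendsto_fst))
  have hpos₀ : ∀ c, c ≠ 0 → 0 < Q x₀ c := by
    intro c hc
    rw [hQ]
    have h1 : ∑ i, c i • Y i x₀ = ((∑ i, c i • b i : P) : ζ.fiber x₀) := by
      simp [hYb]
    rw [h1]
    refine hP _ (Subtype.mem _) fun h => hc ?_
    funext i
    exact Fintype.linearIndependent_iff.1 b.linearIndependent c (Subtype.ext h) i
  have hev : ∀ᶠ x in 𝓝[V] x₀, ∀ c ∈ Metric.sphere (0 : Fin (finrank ℝ P) → ℝ) 1, 0 < Q x c := by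
    rw [eventually_nhdsWithin_iff]
    have h := (isCompact_sphere (0 : Fin (finrank ℝ P) → ℝ) 1).eventually_forall_of_forall_eventually
      (x₀ := x₀) (P := fun x c => x ∈ V → 0 < Q x c) fun c hc => ?_
    · exact h.mono fun x hx hxV c hc => hx c hc hxV
    · have h := (hlim c).eventually (lt_mem_nhds (hpos₀ c (by rintro rfl; simp at hc)))
      rw [← nhdsWithin_univ c, ← nhdsWithin_prod_eq, eventually_nhdsWithin_iff] at h
      exact h.mono fun z hz hzV => hz ⟨hzV, mem_univ _⟩
  filter_upwards [hev] with x hx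
  have hpos : ∀ c, c ≠ 0 → 0 < Q x c := by
    intro c hc
    have hc' : 0 < ‖c‖ := norm_pos_iff.2 hc
    have h1 := hx (‖c‖⁻¹ • c) (by simp [norm_smul, hc'.ne'])
    have h2 : Q x (‖c‖⁻¹ • c) = ‖c‖⁻¹ ^ 2 * Q x c := by
      simp only [Q, Finset.mul_sum, Pi.smul_apply, smul_eq_mul]
      exact Finset.sum_congr rfl fun i _ => Finset.sum_congr rfl fun j _ => by ring
    rw [h2] at h1
    exact pos_of_mul_pos_right h1 (by positivity)
  have hli : LinearIndependent ℝ fun i => Y i x := by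
    rw [Fintype.linearIndependent_iff]
    intro c hc
    by_contra h
    have := hpos c fun h' => h fun i => by rw [h']; rfl
    rw [hQ, hc] at this
    simp at this
  refine ⟨Submodule.span ℝ (range fun i => Y i x), ?_, fun v hv hv0 => ?_⟩
  · rw [finrank_span_eq_card hli, Fintype.card_fin]
  · obtain ⟨c, rfl⟩ := (Submodule.mem_span_range_iff_exists_fun ℝ).1 hv
    rw [← hQ]
    refine hpos c ?_
    rintro rfl
    simp at hv0

/-- Semicontinuity: near a point, the sum of index and nullity does not increase, and the index is
at least the number of negative eigenvalues at the point. -/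
theorem FramedField.eventually_type (F : FramedField g ζ r V T ξ p) {x₀ : W} (hx₀ : x₀ ∈ V) :
    ∀ᶠ x in 𝓝 x₀, x ∈ V → p x ≤ p x₀ ∧ p x₀ ≤ finrank ℝ (negEigen (T x)) + 1 := by
  have hB := isInner_ip g ζ
  have h1 : ∀ᶠ x in 𝓝[V] x₀, p x ≤ p x₀ := by
    obtain ⟨P, hP, hP'⟩ := (F.type x₀ hx₀).exists_pos (hB x₀) (ζ.finrank_fiber x₀)
    filter_upwards [eventually_exists_pos (F.smooth V le_rfl) hx₀ hP', self_mem_nhdsWithin]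
      with x ⟨Q, hQ, hQ'⟩ hx
    have := (F.type x hx).finrank_add_le (ζ.finrank_fiber x) hQ'
    omega
  have h2 : ∀ᶠ x in 𝓝[V] x₀, p x₀ ≤ finrank ℝ (negEigen (T x)) + 1 := by
    by_cases h0 : p x₀ = 0
    · exact Filter.Eventually.of_forall fun x => by omega
    obtain ⟨q, hq⟩ := Nat.exists_eq_succ_of_ne_zero h0
    have hF := F.type x₀ hx₀
    rw [hq] at hF
    obtain ⟨P, hP, hP'⟩ := hF.exists_neg (k := ⟨q, hF.le⟩) (hB x₀)
    have hneg : ∀ X : (∀ x, ζ.fiber x), SmoothAlong r V (fun x => (X x : TangentSpace (𝓡 d) x)) →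
        SmoothAlong r V (fun x => ((-T x) (X x) : TangentSpace (𝓡 d) x)) := fun X hX =>
      (SmoothAlong.smul (FunSmoothAlong.const (-1)) (F.smooth V le_rfl X hX)).congr
        fun x _ => by simp
    filter_upwards [eventually_exists_pos (g := g) (T := fun x => -T x) (P := P) hneg hx₀
      (fun v hv hv0 => by simpa using hP' v hv hv0), self_mem_nhdsWithin] with x ⟨Q, hQ, hQ'⟩ hx
    have := finrank_le_negEigen (hB x) (F.symm x hx) (P := Q)
      fun v hv hv0 => by simpa using hQ' v hv hv0
    simp only at hP
    omega
  exact eventually_nhdsWithin_iff.1 (h1.and h2)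

theorem FramedType.finrank_negEigen_le {E : Type*} [AddCommGroup E] [Module ℝ E]
    [FiniteDimensional ℝ E] {B : LinearMap.BilinForm ℝ E} {T : E →ₗ[ℝ] E} {ξ : Fin n → E} {p : ℕ}
    (h : FramedType B T ξ p) (hB : IsInner B) (hT : ∀ u v, B (T u) v = B u (T v))
    (hn : finrank ℝ E = n) : finrank ℝ (negEigen T) ≤ p := by
  rcases h.cases hB hT hn with ⟨h', -⟩ | ⟨k, hk, -, h', -⟩
  · rw [h', h.orth.finrank_flag h.le]
  · rw [h', (h.orth.mono (by omega)).finrank_flag k.2.le]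
    omega

/-- Lowering the index: if the sum of index and nullity is at most `k + 1` outside of `Ω`, then the
field can be deformed, with the same framing and without change over `Ω`, to a field for which this
sum is at most `k` outside of a given neighbourhood of the closure of `Ω`. -/
theorem FramedField.exists_lower (F : FramedField g ζ r V T ξ p) (hV : IsClosed V) (k : Fin n)
    {Ω Ω' : Set W} (hΩ : IsOpen Ω) (hΩ' : IsOpen Ω') (hsub : closure Ω ⊆ Ω')
    (hp : ∀ x ∈ V, x ∉ Ω → p x ≤ k + 1) :
    ∃ (T' : ∀ x, ζ.fiber x →ₗ[ℝ] ζ.fiber x) (p' : W → ℕ), FramedField g ζ r V T' ξ p' ∧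
      (∀ x ∈ Ω, T' x = T x ∧ p' x = p x) ∧ ∀ x ∈ V, x ∉ Ω' → p' x ≤ k := by
  classical
  have : LocallyCompactSpace W := Manifold.locallyCompact_of_finiteDimensional (𝓡 d)
  have hB := isInner_ip g ζ
  -- the closed set along which the framing vector number `k` has to be extended
  set D : Set W := {x | x ∈ V ∧ (k : ℕ) < p x ∧ x ∉ Ω}
  have hD : IsClosed D := by
    rw [← isOpen_compl_iff, isOpen_iff_mem_nhds]
    intro x hx
    by_cases hxV : x ∈ V
    · by_cases hxΩ : x ∈ Ω
      · filter_upwards [hΩ.mem_nhds hxΩ] with y hy h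
        exact h.2.2 hy
      · have hxp : p x ≤ k := by
          by_contra h
          exact hx ⟨hxV, not_le.1 h, hxΩ⟩
        filter_upwards [F.eventually_type hxV] with y hy h
        exact absurd ((hy h.1).1.trans hxp) (not_le.2 h.2.1)
    · filter_upwards [hV.isOpen_compl.mem_nhds hxV] with y hy h
      exact hy h.1
  have hDp : ∀ x ∈ D, p x = k + 1 := fun x hx =>
    le_antisymm (hp x hx.1 hx.2.2) hx.2.1
  obtain ⟨η, hη, hηD⟩ := exists_global_extension g ζ hD
    ((F.frame k).mono fun x hx => ⟨hx.1, hx.2.1⟩)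
  -- make the extension orthogonal to the previous framing vectors
  set V₁ : Set W := {x | x ∈ V ∧ (k : ℕ) ≤ p x}
  let ν : ∀ x, ζ.fiber x := fun x =>
    η x - ∑ i ∈ Finset.univ.filter (fun i : Fin n => (i : ℕ) < k), ip g ζ x (η x) (ξ i x) • ξ i x
  have hηs : ∀ S : Set W, SmoothAlong r S fun x => (η x : TangentSpace (𝓡 d) x) := fun S =>
    SmoothAlong.of_contMDiffOn isOpen_univ (subset_univ _) hη.contMDiffOn
  have hνs : SmoothAlong r V₁ fun x => (ν x : TangentSpace (𝓡 d) x) := by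
    have h := (hηs V₁).sub (SmoothAlong.sum (Finset.univ.filter fun i : Fin n => (i : ℕ) < k)
      (X := fun i x => (ip g ζ x (η x) (ξ i x)) • (ξ i x : TangentSpace (𝓡 d) x)) fun i hi => ?_)
    · exact h.congr fun x _ => by simp [ν]
    · have hi' : (i : ℕ) < k := (Finset.mem_filter.1 hi).2
      have h1 := (F.frame i).mono (S' := V₁) fun x hx => ⟨hx.1, hi'.trans_le hx.2⟩
      exact SmoothAlong.smul ((hηs V₁).inner g h1) h1
  have hνperp : ∀ x ∈ V₁, ∀ i : Fin n, (i : ℕ) < k → ip g ζ x (ν x) (ξ i x) = 0 := by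
    intro x hx i hi
    have ho := (F.type x hx.1).orth
    simp only [ν, map_sub, LinearMap.sub_apply, map_sum, LinearMap.sum_apply, map_smul,
      LinearMap.smul_apply, smul_eq_mul]
    rw [Finset.sum_eq_single i]
    · rw [ho i i (hi.trans_le hx.2) (hi.trans_le hx.2), if_pos rfl]
      ring
    · intro j hj hji
      rw [ho j i ((Finset.mem_filter.1 hj).2.trans_le hx.2) (hi.trans_le hx.2), if_neg hji, mul_zero]
    · intro h
      exact absurd (Finset.mem_filter.2 ⟨Finset.mem_univ i, hi⟩) h
  have hνD : ∀ x ∈ D, ν x = ξ k x := by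
    intro x hx
    have ho := (F.type x hx.1).orth
    simp only [ν, hηD x hx]
    rw [Finset.sum_eq_zero, sub_zero]
    intro i hi
    have hi' : (i : ℕ) < k := (Finset.mem_filter.1 hi).2
    have hki : k ≠ i := fun h => hi'.ne (by rw [h])
    rw [ho k i hx.2.1 (hi'.trans hx.2.1), if_neg hki, zero_smul]
  have hunit : ∀ x ∈ D, ip g ζ x (ξ k x) (ξ k x) = 1 := fun x hx => by
    simpa using (F.type x hx.1).orth k k hx.2.1 hx.2.1
  have hnrm := hνs.inner g hνs
  -- the open set over which the extension can be normalized
  set G : Set W := {x₀ | ∀ᶠ x in 𝓝 x₀, x ∈ V → (k : ℕ) ≤ p x ∧ 0 < ip g ζ x (ν x) (ν x)}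
  have hGo : IsOpen G := isOpen_setOfPred_eventually_nhds
  have hDG : D ⊆ G := by
    intro x₀ hx₀
    have h1 := hnrm.continuousOn x₀ ⟨hx₀.1, hx₀.2.1.le⟩
    have h2 : ∀ᶠ x in 𝓝[V₁] x₀, 0 < ip g ζ x (ν x) (ν x) := by
      refine h1.eventually (lt_mem_nhds ?_)
      have : ip g ζ x₀ (ν x₀) (ν x₀) = 1 := by rw [hνD x₀ hx₀, hunit x₀ hx₀]
      change 0 < ip g ζ x₀ (ν x₀) (ν x₀)
      rw [this]
      exact one_pos
    rw [eventually_nhdsWithin_iff] at h2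
    filter_upwards [h2, F.eventually_type hx₀.1] with x h2 h3 hxV
    have h4 := (h3 hxV).2
    have h5 := (F.type x hxV).finrank_negEigen_le (hB x) (F.symm x hxV) (ζ.finrank_fiber x)
    have h6 := hDp x₀ hx₀
    have h7 : (k : ℕ) ≤ p x := by omega
    exact ⟨h7, h2 ⟨hxV, h7⟩⟩
  have hGV : ∀ x ∈ G, x ∈ V → (k : ℕ) ≤ p x ∧ 0 < ip g ζ x (ν x) (ν x) := fun x hx =>
    Filter.Eventually.self_of_nhds hx
  let e : ∀ x, ζ.fiber x := fun x => (√(ip g ζ x (ν x) (ν x)))⁻¹ • ν x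
  have hes : SmoothAlong r (V ∩ G) fun x => (e x : TangentSpace (𝓡 d) x) := by
    have hle : V ∩ G ⊆ V₁ := fun x hx => ⟨hx.1, (hGV x hx.2 hx.1).1⟩
    refine SmoothAlong.smul (Y := fun x => (ν x : TangentSpace (𝓡 d) x))
      (f := fun x => (√(ip g ζ x (ν x) (ν x)))⁻¹) ?_ (hνs.mono hle)
    refine (hnrm.mono hle).comp (φ := fun t => (√t)⁻¹) (isOpen_Ioi (a := (0 : ℝ))) ?_
      fun x hx => (hGV x hx.2 hx.1).2
    intro t ht
    have ht' : (0 : ℝ) < t := ht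
    exact ((Real.contDiffAt_sqrt ht'.ne').inv (Real.sqrt_pos.2 ht').ne').contDiffWithinAt
  have he1 : ∀ x ∈ V ∩ G, ip g ζ x (e x) (e x) = 1 := by
    intro x hx
    have h := (hGV x hx.2 hx.1).2
    simp only [e, map_smul, LinearMap.smul_apply, smul_eq_mul]
    rw [← mul_assoc, ← mul_inv, Real.mul_self_sqrt h.le, inv_mul_cancel₀ h.ne']
  have heperp : ∀ x ∈ V ∩ G, ∀ i : Fin n, (i : ℕ) < k → ip g ζ x (e x) (ξ i x) = 0 := by
    intro x hx i hi
    simp [e, hνperp x ⟨hx.1, (hGV x hx.2 hx.1).1⟩ i hi]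
  have heD : ∀ x ∈ D, e x = ξ k x := by
    intro x hx
    simp [e, hνD x hx, hunit x hx]
  -- the cutoff functions
  set Z : Set W := closure Ω ∪ Gᶜ
  have hZ : IsClosed Z := isClosed_closure.union hGo.isClosed_compl
  have hD' : IsClosed (D \ Ω') := hD.sdiff hΩ'
  have hDZ : D \ Ω' ⊆ Zᶜ := by
    rintro x hx (h | h)
    · exact hx.2 (hsub h)
    · exact h (hDG hx.1)
  obtain ⟨u, hu, hDu, huZ⟩ := normal_exists_closure_subset hD' hZ.isOpen_compl hDZ
  obtain ⟨cf, hcf0, hcf1, hcf⟩ := exists_contMDiffMap_zero_one_of_isClosed (𝓡 d) (n := r)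
    hu.isClosed_compl hD' (disjoint_left.2 fun x hx hx' => hx (hDu hx'))
  obtain ⟨sf, hsf0, hsf1, hsf⟩ := exists_contMDiffMap_zero_one_nhds_of_isClosed (𝓡 d) (n := r)
    hZ isClosed_closure (disjoint_left.2 fun x hx hx' => huZ hx' hx)
  have hsfu : ∀ x ∈ u, sf x = 1 := fun x hx => hsf1.self_of_nhdsSet x (subset_closure hx)
  have hsfZ : ∀ x ∈ Z, sf x = 0 := fun x hx => hsf0.self_of_nhdsSet x hx
  have hcfu : ∀ x, x ∉ u → cf x = 0 := fun x hx => hcf0 hx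
  have hcfZ : ∀ x ∈ Z, cf x = 0 := fun x hx => hcfu x fun h => huZ (subset_closure h) hx
  let a : W → ℝ := fun x => ip g ζ x (T x (e x)) (e x)
  let c : W → ℝ := fun x => cf x * (1 + a x * a x)
  let T' : ∀ x, ζ.fiber x →ₗ[ℝ] ζ.fiber x := fun x => bend (ip g ζ x) (T x) (e x) (sf x) (c x)
  let p' : W → ℕ := fun x => if x ∈ D ∧ 0 < a x + c x then k else p x
  have hT' : ∀ x, sf x = 0 → cf x = 0 → T' x = T x := by
    intro x h1 h2
    simp only [T', c, h1, h2, zero_mul, bend_zero]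
  have hsc : ∀ x, sf x = 1 ∨ c x = 0 := by
    intro x
    by_cases hx : x ∈ u
    · exact Or.inl (hsfu x hx)
    · right
      simp [c, hcfu x hx]
  refine ⟨T', p', ⟨?_, ?_, ?_, ?_⟩, ?_, ?_⟩
  · intro S hS X hX
    refine SmoothAlong.of_nhds fun x₀ hx₀ => ?_
    by_cases hxZ : x₀ ∈ Z
    · have h1 : ∀ᶠ x in 𝓝 x₀, sf x = 0 := Filter.Eventually.filter_mono (nhds_le_nhdsSet hxZ) hsf0
      have h2 : ∀ᶠ x in 𝓝 x₀, cf x = 0 := by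
        filter_upwards [isClosed_closure.isOpen_compl.mem_nhds fun h => huZ h hxZ] with x hx
        exact hcfu x fun h => hx (subset_closure h)
      obtain ⟨N, hN, hNo, hxN⟩ := eventually_nhds_iff.1 (h1.and h2)
      refine ⟨N, hNo, hxN, ((F.smooth S hS X hX).mono inter_subset_left).congr fun x hx => ?_⟩
      rw [hT' x (hN x hx.2).1 (hN x hx.2).2]
    · refine ⟨Zᶜ, hZ.isOpen_compl, hxZ, ?_⟩
      have hsubG : S ∩ Zᶜ ⊆ V ∩ G := fun x hx =>
        ⟨hS hx.1, by by_contra h; exact hx.2 (Or.inr h)⟩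
      have hXN := hX.mono (S' := S ∩ Zᶜ) inter_subset_left
      have heN := hes.mono hsubG
      have hSV : S ∩ Zᶜ ⊆ V := fun x hx => hS hx.1
      have hTe := F.smooth _ hSV e heN
      have ha := hTe.inner g heN
      refine smoothAlong_bend hXN (F.smooth _ hSV X hXN) heN hTe
        (FunSmoothAlong.of_contMDiffOn isOpen_univ (subset_univ _) sf.contMDiff.contMDiffOn) ?_
      refine (FunSmoothAlong.of_contMDiffOn isOpen_univ (subset_univ _)
        cf.contMDiff.contMDiffOn).mul (f := fun x => cf x) ?_
      -- `1 + a²` is `1 - (0 - a) a`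
      exact ((FunSmoothAlong.const 1).sub (((FunSmoothAlong.const 0).sub ha).mul ha)).congr
        fun x _ => by simp only [a, ip_apply]; ring
  · intro x hx
    exact bend_symm _ _ (hB x) (F.symm x hx)
  · intro x hx
    by_cases hxD : x ∈ D
    · have hF := F.type x hx
      rw [hDp x hxD] at hF
      have h := hF.bend_last (s := sf x) (c := c x) (hB x) (F.symm x hx) (hsf x).2 (hsf x).1 (hsc x)
      simp only [← heD x hxD] at h
      by_cases hac : 0 < a x + c x
      · simp only [p', hxD, hac, true_and, if_true]
        exact h.2 hac
      · simp only [p', hxD, hac, true_and, if_false, hDp x hxD]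
        exact h.1 (not_lt.1 hac)
    · simp only [p', hxD, false_and, if_false]
      by_cases hxZ : x ∈ Z
      · rw [hT' x (hsfZ x hxZ) (hcfZ x hxZ)]
        exact F.type x hx
      · have hxG : x ∈ G := by
          by_contra h
          exact hxZ (Or.inr h)
        have hxΩ : x ∉ Ω := fun h => hxZ (Or.inl (subset_closure h))
        have hpk : p x = k := by
          refine le_antisymm ?_ (hGV x hxG hx).1
          by_contra h
          exact hxD ⟨hx, not_le.1 h, hxΩ⟩
        refine (F.type x hx).bend_perp (hB x) (F.symm x hx) (hsf x).2 (hsf x).1 ?_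
          (he1 x ⟨hx, hxG⟩) ?_
        · exact mul_nonneg (hcf x).1 (add_nonneg zero_le_one (mul_self_nonneg _))
        · rw [hpk]
          exact heperp x ⟨hx, hxG⟩
  · intro i
    refine (F.frame i).mono fun x hx => ⟨hx.1, hx.2.trans_le ?_⟩
    by_cases h : x ∈ D ∧ 0 < a x + c x
    · simp only [p', h, true_and, if_true]
      exact h.1.2.1.le
    · simp only [p', h, if_false, le_refl]
  · intro x hx
    have hxZ : x ∈ Z := Or.inl (subset_closure hx)
    refine ⟨hT' x (hsfZ x hxZ) (hcfZ x hxZ), ?_⟩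
    have : x ∉ D := fun h => h.2.2 hx
    simp [p', this]
  · intro x hx hxΩ'
    by_cases hxD : x ∈ D
    · have h1 : cf x = 1 := hcf1 ⟨hxD, hxΩ'⟩
      have h2 : 0 < a x + c x := by
        simp only [c, h1]
        nlinarith [sq_nonneg (a x + 1)]
      simp [p', hxD, h2]
    · simp only [p', hxD, false_and, if_false]
      by_contra h
      exact hxD ⟨hx, not_le.1 h, fun h' => hxΩ' (hsub (subset_closure h'))⟩

end FramedField

/-! ### Formal leafwise Igusa functions as framed operator fields -/

section FormalData

open Module

variable {n d : ℕ} {W : Type*} [TopologicalSpace W]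
  [ChartedSpace (EuclideanSpace ℝ (Fin d)) W] [IsManifold (𝓡 d) ∞ W]
  {g : Metric d W} {ζ : PlaneField n d W} {r : ℕ∞} {U V : Set W} {Φ : FormalData ζ}
  {T : ∀ x, ζ.fiber x →ₗ[ℝ] ζ.fiber x} {ξ : Fin n → ∀ x, ζ.fiber x} {p : W → ℕ}

theorem FormalData.index_eq (x : W) : Φ.index x = finrank ℝ (negEigen (Φ.hess x)) := rfl

open Classical in
/-- The sum of the index and the nullity of `Φ²`. -/
noncomputable def FormalData.level (Φ : FormalData ζ) (U : Set W) (x : W) : ℕ :=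
  if x ∈ Φ.Sing U then Φ.index x + 1 else Φ.index x

theorem FormalData.level_of_mem {x : W} (hx : x ∈ Φ.Sing U) : Φ.level U x = Φ.index x + 1 :=
  if_pos hx

theorem FormalData.level_of_notMem {x : W} (hx : x ∉ Φ.Sing U) : Φ.level U x = Φ.index x :=
  if_neg hx

/-- At the points of the zero set of `Φ¹` that are regular, the normal form of `Φ²` is the one
without kernel, at the singular points the one with kernel. -/
theorem FramedField.cases (F : FramedField g ζ r (Φ.V U) Φ.hess ξ p) {x : W} (hx : x ∈ Φ.V U) :
    (x ∉ Φ.Sing U ∧ Φ.negSpace x = flag (fun i => ξ i x) (p x) ∧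
        finrank ℝ (LinearMap.range (Φ.hess x)) = n ∧ Φ.index x = p x) ∨
      (x ∈ Φ.Sing U ∧ ∃ k : Fin n, (k : ℕ) + 1 = p x ∧ Φ.hess x (ξ k x) = 0 ∧
        Φ.negSpace x = flag (fun i => ξ i x) k ∧ Φ.index x = k) := by
  have h := F.type x hx
  rcases h.cases (isInner_ip g ζ x) (F.symm x hx) (ζ.finrank_fiber x) with
    ⟨h1, h2⟩ | ⟨k, hk, hk0, h1, h2⟩
  · refine Or.inl ⟨fun hS => ?_, h1, h2, ?_⟩
    · have := hS.2
      omega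
    · rw [FormalData.index_eq, h1, h.orth.finrank_flag h.le]
  · refine Or.inr ⟨⟨hx, h2⟩, k, hk, hk0, h1, ?_⟩
    rw [FormalData.index_eq, h1, (h.orth.mono (by omega)).finrank_flag k.2.le]

/-- The domain of the framing vector field number `i` consists of points where `i < p`. -/
theorem FramedField.lt_of_mem_frameDomain (F : FramedField g ζ r (Φ.V U) Φ.hess ξ p) {i : ℕ}
    {x : W} (hx : x ∈ Φ.frameDomain U i) : x ∈ Φ.V U ∧ i < p x := by
  obtain ⟨m, him, hx | hx⟩ := hx
  · refine ⟨hx.1.1, ?_⟩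
    rcases F.cases hx.1.1 with h | ⟨-, k, hk, -, -, hi⟩
    · exact absurd hx.1 h.1
    · have := hx.2
      omega
  · refine ⟨hx.1.1, ?_⟩
    rcases F.cases hx.1.1 with h | h
    · have := hx.2
      omega
    · exact absurd h.1 hx.1.2

theorem FramedField.isFraming (F : FramedField g ζ r (Φ.V U) Φ.hess ξ p)
    (hlam : ∀ x, ∀ k : Fin n, (k : ℕ) + 1 = p x → Φ.lam x = ξ k x) : IsFraming g r U Φ ξ where
  smooth i := (F.frame i).mono fun _ hx => F.lt_of_mem_frameDomain hx
  unit i x hx := by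
    obtain ⟨hxV, hi⟩ := F.lt_of_mem_frameDomain hx
    have := (F.type x hxV).orth i i hi hi
    rwa [if_pos rfl] at this
  eq_lam i x hx := by
    rcases F.cases hx.1.1 with h | ⟨-, k, hk, -, -, hi⟩
    · exact absurd hx.1 h.1
    · have := hx.2
      exact (hlam x i (by omega)).symm
  orthogonal m x hx i j hi hj hij := by
    have hm : x ∈ Φ.V U ∧ m ≤ p x := by
      rcases hx with hx | hx
      · refine ⟨hx.1.1, ?_⟩
        rcases F.cases hx.1.1 with h | h
        · exact (hx.2.symm.trans h.2.2.2).le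
        · exact absurd h.1 hx.1.2
      · refine ⟨hx.1.1, ?_⟩
        rcases F.cases hx.1.1 with h | ⟨-, k, hk, -, -, hi⟩
        · exact absurd hx.1 h.1
        · have := hx.2
          omega
    have := (F.type x hm.1).orth i j (hi.trans_le hm.2) (hj.trans_le hm.2)
    rwa [if_neg hij] at this
  span_eq m x hx := by
    rcases hx with hx | hx
    · rcases F.cases hx.1.1 with h | h
      · rw [h.2.1, ← h.2.2.2, hx.2]
        rfl
      · exact absurd h.1 hx.1.2
    · rcases F.cases hx.1.1 with h | ⟨-, k, hk, -, h, hi⟩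
      · exact absurd hx.1 h.1
      · rw [h, ← hi, hx.2]
        rfl

variable [T2Space W] [SecondCountableTopology W]

/-- The operator field of a framed formal leafwise Igusa function. -/
theorem IsFraming.framedField (hξ : IsFraming g r U Φ ξ) (hΦ : IsFLIF g r U Φ) :
    FramedField g ζ r (Φ.V U) Φ.hess ξ (Φ.level U) := by
  have hB := isInner_ip g ζ
  refine ⟨fun S hS X hX => SmoothAlong.of_nhds fun x₀ hx₀ => ?_, hΦ.hess_symm, fun x hx => ?_,
    fun i => (hξ.smooth i).mono ?_⟩
  · obtain ⟨N, hN, hx, Y, hY, he⟩ := exists_global_extension_nhds g ζ hX hx₀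
    have h := hΦ.hess_smooth Y
      (SmoothAlong.of_contMDiffOn isOpen_univ (subset_univ _) hY.contMDiffOn)
    exact ⟨N, hN, hx, (h.mono (inter_subset_left.trans hS)).congr fun x hx => by rw [he x hx]⟩
  · by_cases hS : x ∈ Φ.Sing U
    · rw [FormalData.level_of_mem hS]
      have hlt : Φ.index x < n :=
        finrank_negEigen_lt (hB x) (hΦ.hess_symm x hx) (ζ.finrank_fiber x) hS.2
      have hst : x ∈ Φ.SingStratum U (Φ.index x) := ⟨hS, rfl⟩
      have hlam := hξ.eq_lam ⟨Φ.index x, hlt⟩ x hst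
      refine framedType_of_singular (k := ⟨Φ.index x, hlt⟩) (hB x) (hΦ.hess_symm x hx)
        (ζ.finrank_fiber x) hS.2
        (OrthonormalUpTo.of_unit (hξ.orthogonal _ x (Or.inr hst)) fun i hi => ?_)
        (hξ.span_eq _ x (Or.inr hst)) ?_ ?_
      · exact hξ.unit i x ⟨_, le_of_lt hi, Or.inl hst⟩
      · rw [hlam]
        exact hΦ.lam_ker x hS
      · rw [hlam]
        exact hΦ.lam_unit x hS
    · rw [FormalData.level_of_notMem hS]
      have hst : x ∈ Φ.VStratum U (Φ.index x) := ⟨⟨hx, hS⟩, rfl⟩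
      refine framedType_of_regular (hB x) (hΦ.hess_symm x hx)
        (ζ.finrank_fiber x) (hΦ.hess_rank x ⟨hx, hS⟩)
        (OrthonormalUpTo.of_unit (hξ.orthogonal _ x (Or.inl hst)) fun i hi => ?_) rfl
        (hξ.span_eq _ x (Or.inl hst))
      exact hξ.unit i x ⟨Φ.index x - 1, by omega,
        Or.inr (by rwa [Nat.sub_add_cancel (by omega)])⟩
  · rintro x ⟨hx, hi⟩
    by_cases hS : x ∈ Φ.Sing U
    · rw [FormalData.level_of_mem hS] at hi
      exact ⟨Φ.index x, by omega, Or.inl ⟨hS, rfl⟩⟩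
    · rw [FormalData.level_of_notMem hS] at hi
      exact ⟨Φ.index x - 1, by omega, Or.inr ⟨⟨hx, hS⟩, by omega⟩⟩

/-- The field `λ⁺` is of class `C^r` because, by semicontinuity, the index is locally constant on
the singular set. -/
theorem FramedField.smoothAlong_lam (F : FramedField g ζ r (Φ.V U) Φ.hess ξ p)
    (hlam : ∀ x, ∀ k : Fin n, (k : ℕ) + 1 = p x → Φ.lam x = ξ k x) :
    SmoothAlong r (Φ.Sing U) (fun x => (Φ.lam x : TangentSpace (𝓡 d) x)) := by
  refine SmoothAlong.of_nhds fun x₀ hx₀ => ?_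
  rcases F.cases hx₀.1 with h | ⟨-, k, hk, -⟩
  · exact absurd hx₀ h.1
  obtain ⟨N, hN, hNo, hxN⟩ := eventually_nhds_iff.1 (F.eventually_type hx₀.1)
  have hkN : ∀ x ∈ Φ.Sing U ∩ N, (k : ℕ) + 1 = p x := by
    rintro x ⟨hx, hxN⟩
    have h1 := hN x hxN hx.1
    rcases F.cases hx.1 with h | ⟨-, k', hk', -, -, hi⟩
    · exact absurd hx h.1
    · rw [FormalData.index_eq] at hi
      omega
  refine ⟨N, hNo, hxN, ((F.frame k).mono fun x hx => ?_).congr fun x hx => ?_⟩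
  · have := hkN x hx
    exact ⟨hx.1.1, by omega⟩
  · rw [hlam x k (hkN x hx)]

theorem FramedField.isFLIF (F : FramedField g ζ r (Φ.V U) Φ.hess ξ p)
    (hval : ContMDiffOn (𝓡 d) 𝓘(ℝ, ℝ) r Φ.val U)
    (hgrad : ContMDiffOn (𝓡 d) (𝓡 d).tangent r
      (fun x => (⟨x, (Φ.grad x : TangentSpace (𝓡 d) x)⟩ : TangentBundle (𝓡 d) W)) U)
    (hlam : ∀ x, ∀ k : Fin n, (k : ℕ) + 1 = p x → Φ.lam x = ξ k x) : IsFLIF g r U Φ where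
  val_smooth := hval
  grad_smooth := hgrad
  hess_smooth := F.smooth _ le_rfl
  hess_symm := F.symm
  hess_rank x hx := by
    rcases F.cases hx.1 with h | h
    · exact h.2.2.1
    · exact absurd h.1 hx.2
  lam_smooth := F.smoothAlong_lam hlam
  lam_ker x hx := by
    rcases F.cases hx.1 with h | ⟨-, k, hk, hk0, -⟩
    · exact absurd hx h.1
    · rw [hlam x k hk, hk0]
  lam_unit x hx := by
    rcases F.cases hx.1 with h | ⟨-, k, hk, -⟩
    · exact absurd hx h.1
    · rw [hlam x k hk]
      have := (F.type x hx.1).orth k k (by omega) (by omega)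
      rwa [if_pos rfl] at this

/-- Lowering the index repeatedly makes the operator field positive definite outside of a
neighbourhood of the closure of `Ω`. -/
theorem FramedField.exists_positive (F : FramedField g ζ r V T ξ p) (hV : IsClosed V) {Ω : Set W}
    (m : ℕ) (hm : m ≤ n) (Ω' : Set W) (hΩ' : IsOpen Ω') (hsub : closure Ω ⊆ Ω') :
    ∃ (T' : ∀ x, ζ.fiber x →ₗ[ℝ] ζ.fiber x) (p' : W → ℕ), FramedField g ζ r V T' ξ p' ∧
      (∀ x ∈ Ω, T' x = T x ∧ p' x = p x) ∧ ∀ x ∈ V, x ∉ Ω' → p' x ≤ n - m := by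
  have : LocallyCompactSpace W := Manifold.locallyCompact_of_finiteDimensional (𝓡 d)
  induction m generalizing Ω' with
  | zero => exact ⟨T, p, F, fun x _ => ⟨rfl, rfl⟩, fun x hx _ => (F.type x hx).le⟩
  | succ m ih =>
    obtain ⟨Ω₁, hΩ₁, hsub₁, hsub₂⟩ := normal_exists_closure_subset isClosed_closure hΩ' hsub
    obtain ⟨T₁, p₁, F₁, hag, hp₁⟩ := ih (by omega) Ω₁ hΩ₁ hsub₁
    obtain ⟨T₂, p₂, F₂, hag₂, hp₂⟩ := F₁.exists_lower hV ⟨n - (m + 1), by omega⟩ hΩ₁ hΩ' hsub₂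
      (fun x hx hxΩ => (hp₁ x hx hxΩ).trans (by simp only; omega))
    refine ⟨T₂, p₂, F₂, fun x hx => ?_, hp₂⟩
    have hx₁ := hsub₁ (subset_closure hx)
    exact ⟨(hag₂ x hx₁).1.trans (hag x hx).1, (hag₂ x hx₁).2.trans (hag x hx).2⟩

end FormalData

/-! ### Extension to the whole manifold -/

section Globalization

open Module

variable {n d : ℕ} {W : Type*} [TopologicalSpace W]
  [ChartedSpace (EuclideanSpace ℝ (Fin d)) W] [IsManifold (𝓡 d) ∞ W]
  {g : Metric d W} {ζ : PlaneField n d W} {r : ℕ∞} {V V' : Set W}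
  {T : ∀ x, ζ.fiber x →ₗ[ℝ] ζ.fiber x} {ξ : Fin n → ∀ x, ζ.fiber x} {p : W → ℕ}

theorem isClosed_V_inter {U E : Set W} {Φ : FormalData ζ} (hΦ : IsFLIF g r U Φ) (hU : IsOpen U)
    (hE : IsClosed E) (hEU : E ⊆ U) : IsClosed (Φ.V U ∩ E) := by
  have hgr := SmoothAlong.of_contMDiffOn hU hEU hΦ.grad_smooth
  have h := (hgr.inner g hgr).continuousOn.preimage_isClosed_of_isClosed hE
    (isClosed_singleton (x := (0 : ℝ)))
  convert! h using 1
  ext x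
  constructor
  · rintro ⟨hx, hxE⟩
    refine ⟨hxE, ?_⟩
    simp [hx.2]
  · rintro ⟨hxE, hx⟩
    exact ⟨⟨hEU hxE, (isInner_ip g ζ x).eq_zero hx⟩, hxE⟩

theorem framedType_zero_convex {E : Type*} [AddCommGroup E] [Module ℝ E]
    {B : LinearMap.BilinForm ℝ E} (hB : IsInner B) {T : E →ₗ[ℝ] E} {ξ : Fin n → E} {t : ℝ}
    (ht : t ∈ Icc (0 : ℝ) 1) (hT : t = 1 ∨ FramedType B T ξ 0) :
    FramedType B ((1 - t) • T + t • LinearMap.id) ξ 0 := by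
  refine ⟨Nat.zero_le _, fun i _ hi => absurd hi (Nat.not_lt_zero _),
    fun i hi => absurd hi (Nat.not_lt_zero _), fun v hv _ => ?_, fun v hv => ?_,
    fun v _ _ i hi => absurd hi (Nat.not_lt_zero _)⟩
  · have h1 := hB.pos v hv
    simp only [LinearMap.add_apply, LinearMap.smul_apply, LinearMap.id_apply, map_add, map_smul,
      smul_eq_mul]
    rcases hT with rfl | hT
    · simpa using h1
    · have h2 := hT.pos v hv fun i hi => absurd hi (Nat.not_lt_zero _)
      rcases ht.2.lt_or_eq with h | rfl
      · have := mul_pos (sub_pos.2 h) h2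
        have := mul_nonneg ht.1 h1.le
        linarith
      · simpa using h1
  · have : v = 0 := by simpa [flag] using hv
    simp [this]

/-- An operator field that is positive definite near the boundary of an open set `Ω₁` is deformed to
the identity there, and then extends by the identity to larger sets. -/
theorem FramedField.extend_by_id (F : FramedField g ζ r V T ξ p) {Ω₀ Ω₁ : Set W}
    (hΩ₁ : IsOpen Ω₁) (hsub : Ω₀ ⊆ Ω₁) (hVV' : V' ∩ Ω₁ ⊆ V)
    (hp : ∀ x ∈ V, x ∉ Ω₀ → p x = 0) {θ : W → ℝ} (hθs : ContMDiff (𝓡 d) 𝓘(ℝ, ℝ) r θ)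
    (hθ : ∀ x, θ x ∈ Icc (0 : ℝ) 1) (hθ0 : ∀ x ∈ Ω₀, θ x = 0)
    (hθ1 : ∀ x, x ∉ Ω₁ → ∀ᶠ y in 𝓝 x, θ y = 1) :
    ∃ p' : W → ℕ, FramedField g ζ r V' (fun x => (1 - θ x) • T x + θ x • LinearMap.id) ξ p' ∧
      ∀ x ∈ Ω₀, p' x = p x := by
  classical
  have hB := isInner_ip g ζ
  have hθa : ∀ S : Set W, FunSmoothAlong (d := d) r S θ := fun S =>
    FunSmoothAlong.of_contMDiffOn isOpen_univ (subset_univ _) hθs.contMDiffOn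
  refine ⟨fun x => if x ∈ Ω₀ then p x else 0, ⟨?_, ?_, ?_, ?_⟩, fun x hx => if_pos hx⟩
  · intro S hS X hX
    refine SmoothAlong.of_nhds fun x₀ hx₀ => ?_
    by_cases hxΩ : x₀ ∈ Ω₁
    · refine ⟨Ω₁, hΩ₁, hxΩ, ?_⟩
      have hXN := hX.mono (S' := S ∩ Ω₁) inter_subset_left
      have hTX := F.smooth (S ∩ Ω₁) (fun x hx => hVV' ⟨hS hx.1, hx.2⟩) X hXN
      exact ((SmoothAlong.smul ((FunSmoothAlong.const 1).sub (hθa _)) hTX).add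
        (SmoothAlong.smul (hθa _) hXN)).congr fun x _ => by simp
    · obtain ⟨N, hN, hNo, hxN⟩ := eventually_nhds_iff.1 (hθ1 x₀ hxΩ)
      exact ⟨N, hNo, hxN, (hX.mono inter_subset_left).congr fun x hx => by simp [hN x hx.2]⟩
  · intro x hx u v
    by_cases hxΩ : x ∈ Ω₁
    · have := F.symm x (hVV' ⟨hx, hxΩ⟩) u v
      simp [this]
    · simp [(hθ1 x hxΩ).self_of_nhds]
  · intro x hx
    by_cases hx₀ : x ∈ Ω₀
    · simp only [hx₀, if_true, hθ0 x hx₀, sub_zero, one_smul, zero_smul, add_zero]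
      exact F.type x (hVV' ⟨hx, hsub hx₀⟩)
    · simp only [hx₀, if_false]
      refine framedType_zero_convex (hB x) (hθ x) ?_
      by_cases hxΩ : x ∈ Ω₁
      · have hxV := hVV' ⟨hx, hxΩ⟩
        right
        have := F.type x hxV
        rwa [hp x hxV hx₀] at this
      · exact Or.inl (hθ1 x hxΩ).self_of_nhds
  · intro i
    refine (F.frame i).mono ?_
    rintro x ⟨hx, hi⟩
    by_cases hx₀ : x ∈ Ω₀
    · simp only [hx₀, if_true] at hi
      exact ⟨hVV' ⟨hx, hsub hx₀⟩, hi⟩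
    · simp [hx₀] at hi

end Globalization

end FormalIgusa

theorem theorem3p8p1 (n k : ℕ) (W : Type*) [TopologicalSpace W] [T2Space W]
    [SecondCountableTopology W] [ChartedSpace (EuclideanSpace ℝ (Fin (n + k))) W]
    [IsManifold (𝓡 (n + k)) ∞ W] (g : FormalIgusa.Metric (n + k) W)
    (ζ : FormalIgusa.PlaneField n (n + k) W) (r : ℕ∞) (A U : Set W) (hA : IsClosed A)
    (hU : IsOpen U) (hAU : A ⊆ U) (Φ : FormalIgusa.FormalData ζ) (ξ : Fin n → ∀ x, ζ.fiber x)
    (hΦ : FormalIgusa.IsFLIF g r U Φ) (hξ : FormalIgusa.IsFraming g r U Φ ξ) :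
    ∃ (Φ' : FormalIgusa.FormalData ζ) (ξ' : Fin n → ∀ x, ζ.fiber x),
      FormalIgusa.IsFLIF g r univ Φ' ∧ FormalIgusa.IsFraming g r univ Φ' ξ' ∧
      ∃ O : Set W, IsOpen O ∧ A ⊆ O ∧ O ⊆ U ∧ FormalIgusa.AgreeOn O Φ Φ' ξ ξ' := by
  classical
  have : LocallyCompactSpace W := Manifold.locallyCompact_of_finiteDimensional (𝓡 (n + k))
  obtain ⟨Ω₂, hΩ₂, hAΩ₂, hΩ₂U⟩ := normal_exists_closure_subset hA hU hAU
  obtain ⟨Ω₁, hΩ₁, hAΩ₁, hΩ₁₂⟩ := normal_exists_closure_subset hA hΩ₂ hAΩ₂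
  obtain ⟨Ω₀, hΩ₀, hAΩ₀, hΩ₀₁⟩ := normal_exists_closure_subset hA hΩ₁ hAΩ₁
  obtain ⟨O, hO, hAO, hOΩ₀⟩ := normal_exists_closure_subset hA hΩ₀ hAΩ₀
  have hOΩ₀' : O ⊆ Ω₀ := subset_closure.trans hOΩ₀
  have hΩ₀₁' : Ω₀ ⊆ Ω₁ := subset_closure.trans hΩ₀₁
  have hΩ₁₂' : Ω₁ ⊆ Ω₂ := subset_closure.trans hΩ₁₂
  have hOU : O ⊆ U := hOΩ₀'.trans (hΩ₀₁'.trans (hΩ₁₂'.trans (subset_closure.trans hΩ₂U)))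
  -- deform the operator field along the part of the zero set over a closed neighbourhood of `A`
  have hF := hξ.framedField hΦ
  obtain ⟨T, p, F, hag, hp⟩ := (hF.mono inter_subset_left).exists_positive
    (FormalIgusa.isClosed_V_inter hΦ hU isClosed_closure hΩ₂U) n le_rfl Ω₀ hΩ₀ hOΩ₀
  -- cut off the function and the vector field
  obtain ⟨χ, hχ0, hχ1, -⟩ := exists_contMDiffMap_zero_one_of_isClosed (𝓡 (n + k)) (n := r)
    hΩ₂.isClosed_compl isClosed_closure (disjoint_left.2 fun x hx hx' => hx (hΩ₁₂ hx'))
  have hχsupp : tsupport χ ⊆ U := by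
    refine (closure_mono fun x hx => ?_).trans hΩ₂U
    by_contra h
    exact hx (hχ0 h)
  obtain ⟨θ, hθ0, hθ1, hθ⟩ := exists_contMDiffMap_zero_one_nhds_of_isClosed (𝓡 (n + k)) (n := r)
    isClosed_closure hΩ₁.isClosed_compl (disjoint_left.2 fun x hx hx' => hx' (hΩ₀₁ hx))
  have hχΩ₁ : ∀ x ∈ Ω₁, χ x = 1 := fun x hx => hχ1 (subset_closure hx)
  have hθΩ₀ : ∀ x ∈ Ω₀, θ x = 0 := fun x hx => hθ0.self_of_nhdsSet x (subset_closure hx)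
  have hVV' : {x | χ x • Φ.grad x = 0} ∩ Ω₁ ⊆ Φ.V U ∩ closure Ω₂ := by
    rintro x ⟨hx, hxΩ⟩
    have hx₂ := subset_closure (hΩ₁₂' hxΩ)
    refine ⟨⟨hΩ₂U hx₂, ?_⟩, hx₂⟩
    simpa [hχΩ₁ x hxΩ] using hx
  obtain ⟨p', F', hp'⟩ := F.extend_by_id hΩ₁ hΩ₀₁' hVV'
    (fun x hx hxΩ => by have := hp x hx hxΩ; omega) θ.contMDiff hθ hθΩ₀
    (fun x hx => Filter.Eventually.filter_mono (nhds_le_nhdsSet hx) hθ1)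
  let Φ' : FormalIgusa.FormalData ζ :=
    { val := fun x => χ x * Φ.val x
      grad := fun x => χ x • Φ.grad x
      hess := fun x => (1 - θ x) • T x + θ x • LinearMap.id
      lam := fun x => if h : ∃ i : Fin n, (i : ℕ) + 1 = p' x then ξ h.choose x else 0 }
  have hlam : ∀ x, ∀ i : Fin n, (i : ℕ) + 1 = p' x → Φ'.lam x = ξ i x := by
    intro x i hi
    have h : ∃ i : Fin n, (i : ℕ) + 1 = p' x := ⟨i, hi⟩
    have h1 : h.choose = i := Fin.ext (by have := h.choose_spec; omega)
    simp only [Φ', dif_pos h, h1]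
  have hV' : Φ'.V univ = {x | χ x • Φ.grad x = 0} := by
    ext x
    exact ⟨fun h => h.2, fun h => ⟨mem_univ _, h⟩⟩
  rw [← hV'] at F'
  have hval : ContMDiffOn (𝓡 (n + k)) 𝓘(ℝ, ℝ) r Φ'.val univ := by
    refine (contMDiff_of_tsupport fun x hx => ?_).contMDiffOn
    have hxU := hχsupp (tsupport_mul_subset_left hx)
    exact χ.contMDiff.contMDiffAt.mul (hΦ.val_smooth.contMDiffAt (hU.mem_nhds hxU))
  have hgrad : ContMDiffOn (𝓡 (n + k)) (𝓡 (n + k)).tangent r (fun x =>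
      (⟨x, (Φ'.grad x : TangentSpace (𝓡 (n + k)) x)⟩ : TangentBundle (𝓡 (n + k)) W)) univ :=
    (ContMDiffOn.smul_section_of_tsupport χ.contMDiff.contMDiffOn hU hχsupp
      hΦ.grad_smooth).contMDiffOn
  refine ⟨Φ', ξ, F'.isFLIF hval hgrad hlam, F'.isFraming hlam, O, hO, hAO, hOU, ?_⟩
  have hχO : ∀ x ∈ O, χ x = 1 := fun x hx => hχΩ₁ x (hΩ₀₁' (hOΩ₀' hx))
  refine ⟨fun x hx => ?_, fun x hx => ?_, fun x hx => ?_, fun x hx => ?_, fun _ _ _ => rfl⟩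
  · simp [Φ', hχO x hx]
  · simp [Φ', hχO x hx]
  · simp [Φ', hθΩ₀ x (hOΩ₀' hx.1), (hag x hx.1).1]
  · have hxO : x ∈ O := hx.1.1
    have hxS : x ∈ Φ.Sing U := ⟨⟨hOU hxO, hx.1.2⟩, hx.2⟩
    rcases hF.cases hxS.1 with h | ⟨-, i, hi, -, -, hidx⟩
    · exact absurd hxS h.1
    · rw [hlam x i (by rw [hp' x (hOΩ₀' hxO), (hag x hxO).2, hi])]
      exact hξ.eq_lam i x ⟨hxS, hidx⟩
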